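/- Let $G \subset O(2) \ltimes \mathbb{R}^2$ be a crystallographic group, i.e. a discrete and cocompact subgroup of the group of congruent transformations of the Euclidean plane. Let $L = \{\nu \in \mathbb{R}^2 : (x \mapsto x + \nu) \in G\}$ be its translation lattice, let $L^* = \{ l^* \in \mathbb{R}^2 : l \cdot l^* \in \mathbb{Z} \text{ for all } l \in L\}$ be the reciprocal lattice of $L$, and let $V = \mathbb{R}^2/L$, on which $G$ acts; write $x^\sigma$ for the image of $x \in V$ under $\sigma \in G$. Let $H$ be a subgroup of $G$ that contains all translations in $G$, let $V^H$ be the set of points of $V$ that are fixed by $H$, and let $U$ be a connected component of $V^H$. Put $$\Gamma_{ext}(G,H,U) = \Bigl\{ l^* \in L^* : \sum_{\sigma \in G/L} e^{-2\pi\sqrt{-1}\, x^\sigma \cdot l^*} = 0 \text{ for all } x \in U \Bigr\}.$$ Assume that there is no lattice $L_2 \supsetneq L$ of $\mathbb{R}^2$ whose reciprocal lattice $L_2^*$ contains $L^* \setminus \Gamma_{ext}(G,H,U)$. Then for every primitive vector $l^*$ of $L^*$ (a vector that is a member of some basis of $L^*$) with $l^* \in \Gamma_{ext}(G,H,U)$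 there exists $l_2^* \in L^*$ such that $l^* \cdot l_2^* = 0$ and $\{l^*, l_2^*\}$ is a basis of $L^*$. -/

import Mathlib

/-- The Euclidean space `ℝ^N`. -/
abbrev Euc (N : ℕ) : Type := EuclideanSpace ℝ (Fin N)

/-- The group `O(N) ⋉ ℝ^N` of all congruent transformations of `ℝ^N`. -/
abbrev CongruenceGroup (N : ℕ) : Type := Euc N ≃ᵃⁱ[ℝ] Euc N

/-- The orthogonal part `τ` of a congruent transformation `{τ | ν} : x ↦ τ x + ν`. -/
noncomputable def orthPart {N : ℕ} (σ : CongruenceGroup N) : Euc N →L[ℝ] Euc N :=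
  (σ.linearIsometryEquiv.toContinuousLinearEquiv : Euc N →L[ℝ] Euc N)

theorem apply_eq_orthPart_add {N : ℕ} (σ : CongruenceGroup N) (x : Euc N) :
    σ x = orthPart σ x + σ 0 := by
  have h := σ.map_vadd 0 x
  simpa [orthPart] using h

/-- The topology of `O(N) ⋉ ℝ^N`: the product topology on the pairs `(τ, ν)`, where
`{τ | ν}` is the transformation `x ↦ τ x + ν`. -/
noncomputable instance congruenceGroupTopology (N : ℕ) : TopologicalSpace (CongruenceGroup N) :=
  TopologicalSpace.induced (fun σ => (orthPart σ, σ 0)) inferInstance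

/-- Crystallographic groups: discrete and cocompact subgroups of `O(N) ⋉ ℝ^N`. -/
structure IsCrystallographic {N : ℕ} (G : Subgroup (CongruenceGroup N)) : Prop where
  discrete : DiscreteTopology G
  cocompact : CompactSpace (CongruenceGroup N ⧸ G)

/-- The translation `x ↦ ν + x`. -/
noncomputable def transl {N : ℕ} (ν : Euc N) : CongruenceGroup N :=
  AffineIsometryEquiv.constVAdd ℝ (Euc N) ν

theorem transl_apply {N : ℕ} (ν x : Euc N) : transl ν x = ν + x := rfl

theorem transl_add {N : ℕ} (ν μ : Euc N) : transl (ν + μ) = transl ν * transl μ := by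
  ext1 x
  exact add_assoc ν μ x

theorem transl_zero {N : ℕ} : transl (0 : Euc N) = 1 := by
  ext1 x
  exact zero_add x

theorem transl_neg {N : ℕ} (ν : Euc N) : transl (-ν) = (transl ν)⁻¹ := by
  rw [eq_inv_iff_mul_eq_one, ← transl_add, neg_add_cancel, transl_zero]

/-- The set `L` of the vectors of all the translations in `G`. -/
def translationLattice {N : ℕ} (G : Subgroup (CongruenceGroup N)) : Submodule ℤ (Euc N) :=
  AddSubgroup.toIntSubmodule
    { carrier := {ν | transl ν ∈ G}
      add_mem' := fun {a b} ha hb => by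
        simp only [Set.mem_ofPred_eq, transl_add] at *
        exact G.mul_mem ha hb
      zero_mem' := by
        simp only [Set.mem_ofPred_eq, transl_zero]
        exact G.one_mem
      neg_mem' := fun {a} ha => by
        simp only [Set.mem_ofPred_eq, transl_neg] at *
        exact G.inv_mem ha }

theorem mem_translationLattice {N : ℕ} {G : Subgroup (CongruenceGroup N)} {ν : Euc N} :
    ν ∈ translationLattice G ↔ transl ν ∈ G := Iff.rfl

/-- The translations in `G`, as a subgroup of `G`. -/
def translationSubgroup {N : ℕ} (G : Subgroup (CongruenceGroup N)) : Subgroup G where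
  carrier := {σ | ∃ ν : Euc N, (σ : CongruenceGroup N) = transl ν}
  mul_mem' := by
    rintro a b ⟨ν, ha⟩ ⟨μ, hb⟩
    exact ⟨ν + μ, by rw [Subgroup.coe_mul, ha, hb, transl_add]⟩
  one_mem' := ⟨0, transl_zero.symm⟩
  inv_mem' := by
    rintro a ⟨ν, ha⟩
    exact ⟨-ν, by rw [Subgroup.coe_inv, ha, transl_neg]⟩

/-- The orthogonal parts of the elements of `G` map `L` to `L`. -/
theorem orthPart_mem {N : ℕ} {G : Subgroup (CongruenceGroup N)} {σ : CongruenceGroup N}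
    (hσ : σ ∈ G) {ν : Euc N} (hν : ν ∈ translationLattice G) :
    orthPart σ ν ∈ translationLattice G := by
  have h : transl (orthPart σ ν) = σ * transl ν * σ⁻¹ := by
    rw [eq_mul_inv_iff_mul_eq]
    ext1 x
    change orthPart σ ν + σ x = σ (ν + x)
    rw [apply_eq_orthPart_add σ (ν + x), apply_eq_orthPart_add σ x, map_add, add_assoc]
  rw [mem_translationLattice] at *
  rw [h]
  exact G.mul_mem (G.mul_mem hσ hν) (G.inv_mem hσ)

/-- The quotient `V = ℝ^N / L`, with its quotient topology. -/
abbrev TorusOf {N : ℕ} (G : Subgroup (CongruenceGroup N)) : Type :=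
  Euc N ⧸ translationLattice G

/-- The action of `G` on `V = ℝ^N / L`: the element `{τ | ν}` maps `x` to `τ x + ν`. -/
noncomputable def torusActionMap {N : ℕ} {G : Subgroup (CongruenceGroup N)} (σ : G) (v : TorusOf G) :
    TorusOf G :=
  Submodule.mapQ (translationLattice G) (translationLattice G)
      ((orthPart (σ : CongruenceGroup N)).toLinearMap.restrictScalars ℤ)
      (fun _ hν => orthPart_mem σ.2 hν) v
    + Submodule.Quotient.mk ((σ : CongruenceGroup N) 0)

theorem torusActionMap_mk {N : ℕ} {G : Subgroup (CongruenceGroup N)} (σ : G) (x : Euc N) :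
    torusActionMap σ (Submodule.Quotient.mk x : TorusOf G)
      = Submodule.Quotient.mk ((σ : CongruenceGroup N) x) := by
  rw [apply_eq_orthPart_add (σ : CongruenceGroup N) x]
  rfl

noncomputable instance torusAction {N : ℕ} (G : Subgroup (CongruenceGroup N)) :
    MulAction G (TorusOf G) where
  smul := torusActionMap
  one_smul := by
    intro v
    obtain ⟨x, rfl⟩ := Submodule.Quotient.mk_surjective _ v
    exact torusActionMap_mk 1 x
  mul_smul := by
    intro σ τ v
    obtain ⟨x, rfl⟩ := Submodule.Quotient.mk_surjective _ v
    change torusActionMap (σ * τ) _ = torusActionMap σ (torusActionMap τ _)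
    rw [torusActionMap_mk, torusActionMap_mk, torusActionMap_mk]
    rfl

theorem smul_mk_torus {N : ℕ} {G : Subgroup (CongruenceGroup N)} (σ : G) (x : Euc N) :
    σ • (Submodule.Quotient.mk x : TorusOf G)
      = Submodule.Quotient.mk ((σ : CongruenceGroup N) x) := torusActionMap_mk σ x

/-- The reciprocal lattice `{y | x ⬝ y ∈ ℤ for all x ∈ Λ}` of `Λ`. -/
noncomputable def reciprocal {N : ℕ} (Λ : Submodule ℤ (Euc N)) : Submodule ℤ (Euc N) :=
  LinearMap.BilinForm.dualSubmodule (innerₗ (Euc N)) Λ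

theorem mem_reciprocal {N : ℕ} {Λ : Submodule ℤ (Euc N)} {y : Euc N} :
    y ∈ reciprocal Λ ↔ ∀ x ∈ Λ, ∃ n : ℤ, inner ℝ x y = (n : ℝ) := by
  change (∀ x ∈ Λ, inner ℝ y x ∈ (1 : Submodule ℤ ℝ)) ↔ _
  simp only [Submodule.mem_one, real_inner_comm y, eq_comm, eq_intCast]

/-- The function `x ↦ exp(-2π√-1 x ⬝ l)` on `V = ℝ^N / L`, for `l` in the reciprocal lattice. -/
noncomputable def torusChar {N : ℕ} {G : Subgroup (CongruenceGroup N)}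
    (l : reciprocal (translationLattice G)) (v : TorusOf G) : ℂ :=
  Quotient.liftOn' v
    (fun x : Euc N => Complex.exp (-2 * Real.pi * Complex.I * (inner ℝ x (l : Euc N) : ℝ)))
    (by
      intro a b hab
      have h : a - b ∈ translationLattice G := (Submodule.quotientRel_def _).mp hab
      obtain ⟨n, hn⟩ := mem_reciprocal.mp l.2 _ h
      rw [inner_sub_left, sub_eq_iff_eq_add] at hn
      change Complex.exp _ = Complex.exp _
      rw [hn, Complex.exp_eq_exp_iff_exists_int]
      refine ⟨-n, ?_⟩
      push_cast
      ring)

theorem torusChar_mk {N : ℕ} {G : Subgroup (CongruenceGroup N)}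
    (l : reciprocal (translationLattice G)) (x : Euc N) :
    torusChar l (Submodule.Quotient.mk x : TorusOf G)
      = Complex.exp (-2 * Real.pi * Complex.I * (inner ℝ x (l : Euc N) : ℝ)) := rfl

/-- Translations in `G` act trivially on `V`. -/
theorem translation_smul {N : ℕ} {G : Subgroup (CongruenceGroup N)} {σ : G}
    (hσ : σ ∈ translationSubgroup G) (v : TorusOf G) : σ • v = v := by
  obtain ⟨ν, hν⟩ := hσ
  obtain ⟨x, rfl⟩ := Submodule.Quotient.mk_surjective _ v
  rw [smul_mk_torus, hν, transl_apply, Submodule.Quotient.eq, add_sub_cancel_right,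
    mem_translationLattice, ← hν]
  exact σ.2

/-- The term `exp(-2π√-1 x^σ ⬝ l)`, as a function of the class of `σ` in `G / L`. -/
noncomputable def structureTerm {N : ℕ} {G : Subgroup (CongruenceGroup N)}
    (l : reciprocal (translationLattice G)) (v : TorusOf G) (q : G ⧸ translationSubgroup G) : ℂ :=
  Quotient.liftOn' q (fun σ : G => torusChar l (σ • v))
    (by
      intro σ τ h
      have h' : σ⁻¹ * τ ∈ translationSubgroup G := QuotientGroup.leftRel_apply.mp h
      have e : τ = σ * (σ⁻¹ * τ) := by group
      change torusChar l (σ • v) = torusChar l (τ • v)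
      rw [e, mul_smul, translation_smul h'])

/-- `W_{G,l}`: the set of all `x ∈ V` with `∑_{σ ∈ G / L} exp(-2π√-1 x^σ ⬝ l) = 0`. For a
crystallographic group `G`, the index set `G / L` of the sum is finite. -/
def vanishingSet {N : ℕ} {G : Subgroup (CongruenceGroup N)}
    (l : reciprocal (translationLattice G)) : Set (TorusOf G) :=
  {v | ∑ᶠ q : G ⧸ translationSubgroup G, structureTerm l v q = 0}

/-- `(G, H, U)` is a type of systematic absence: `G` is a crystallographic group, `H` is a
subgroup with `L ⊆ H ⊆ G`, and `U` is a connected component of the set `V^H` of the points of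
`V = ℝ^N / L` that are fixed by `H`. -/
structure IsAbsenceType {N : ℕ} (G : Subgroup (CongruenceGroup N)) (H : Subgroup G)
    (U : Set (TorusOf G)) : Prop where
  crystallographic : IsCrystallographic G
  translations_le : translationSubgroup G ≤ H
  component : ∃ x ∈ MulAction.fixedPoints H (TorusOf G),
    U = connectedComponentIn (MulAction.fixedPoints H (TorusOf G)) x

/-- `Γ_ext(G, H, U)`: the set of all `l` in the reciprocal lattice of `L` with `U ⊆ W_{G,l}`. It
depends on `H` only through `U`. -/
def gammaExt {N : ℕ} (G : Subgroup (CongruenceGroup N)) (U : Set (TorusOf G)) :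
    Set (Euc N) :=
  {l | ∃ hl : l ∈ reciprocal (translationLattice G), U ⊆ vanishingSet ⟨l, hl⟩}

/-- The reciprocal lattice vectors outside `Γ_ext(G, H, U)` are not all contained in the
reciprocal lattice of a lattice that is strictly larger than `L`. -/
def DetectsLattice {N : ℕ} (G : Subgroup (CongruenceGroup N)) (U : Set (TorusOf G)) : Prop :=
  ¬ ∃ (L₂ : Submodule ℤ (Euc N)) (_ : DiscreteTopology L₂), IsZLattice ℝ L₂ ∧
    translationLattice G < L₂ ∧
    (reciprocal (translationLattice G) : Set (Euc N)) \ gammaExt G U ⊆ reciprocal L₂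

/-- `v` is a basis of the lattice `Λ`. -/
def IsLatticeBasis {N : ℕ} (Λ : Submodule ℤ (Euc N)) (v : Fin N → Euc N) : Prop :=
  LinearIndependent ℝ v ∧ Submodule.span ℤ (Set.range v) = Λ

/-- `l` is a primitive vector of the lattice `Λ`: it is a member of a basis of `Λ`. -/
def IsPrimitiveVector {N : ℕ} (Λ : Submodule ℤ (Euc N)) (l : Euc N) : Prop :=
  ∃ v : Fin N → Euc N, IsLatticeBasis Λ v ∧ ∃ i, v i = l

/-! The argument splits according to whether some element of `H` has a nontrivial rotation as
orthogonal part.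

Suppose there is none, and let `x` represent a point of `U`. Then `U` contains the image of `x + F`,
where `F` is the space of vectors fixed by the orthogonal parts of `H`. Along `F` the structure
factor is a combination of characters, so by linear independence of characters the coefficients
belonging to each character sum to zero. Applied to the character of the identity, this gives `σ ∈
G` that preserves the pairing with `l` on `F` although `⟨σ x - x, l⟩` is not an integer
(`exists_nonintegral_of_gammaExt`). Such a `σ` leads to a reflection part, that of `σ` or of `σ h`
with `h ∈ H`, whose axis contains `l`. If `{l, m}` is a basis of `L*` and `A` is that reflection,
then `m + A m = k l` with `k` an integer. For even `k`, `m - (k/2) l` is orthogonal to `l`; for odd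
`k`, the displacements pair integrally with `l`, a contradiction (`orthogonal_basis_or_integral`).

Suppose there is one. Then `H` contains an element `k` whose orthogonal part is a rotation of order
two or three, and `U` is a single point. The displacements of this point under `G` form a set `P` in
a group that is either 2-torsion of order at most 4 or 3-torsion of order at most 3. In so small a
group, a character can sum to zero over `P` only if `P` is a subgroup, and then `P` is nonzero. A
reciprocal vector outside `Γ_ext` has nonzero sum over `P`, hence is trivial on `P`, so it is
reciprocal to the strictly larger lattice that is the preimage of `P`. The hypothesis on `L`
excludes this, so `Γ_ext` is empty (`notMem_gammaExt_of_rotation`). -/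

theorem inner_plane (x y : Euc 2) : inner ℝ x y = x 0 * y 0 + x 1 * y 1 := by
  simp [PiLp.inner_apply, Fin.sum_univ_two, mul_comm]

theorem plane_ext {x y : Euc 2} (h0 : x 0 = y 0) (h1 : x 1 = y 1) : x = y := by
  ext i; fin_cases i <;> assumption

theorem plane_ne_zero {x : Euc 2} (hx : x ≠ 0) : 0 < x 0 ^ 2 + x 1 ^ 2 := by
  by_contra h
  refine hx (plane_ext ?_ ?_)
  · change x 0 = 0; nlinarith [sq_nonneg (x 0), sq_nonneg (x 1)]
  · change x 1 = 0; nlinarith [sq_nonneg (x 0), sq_nonneg (x 1)]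

/-! ### Orthogonal parts and their action on the lattice and its reciprocal -/

section orthPart

variable {N : ℕ}

theorem orthPart_mul (σ τ : CongruenceGroup N) (x : Euc N) :
    orthPart (σ * τ) x = orthPart σ (orthPart τ x) := rfl

theorem orthPart_one (x : Euc N) : orthPart (1 : CongruenceGroup N) x = x := rfl

theorem orthPart_inv_apply (σ : CongruenceGroup N) (x : Euc N) :
    orthPart σ⁻¹ (orthPart σ x) = x := by
  rw [← orthPart_mul, inv_mul_cancel, orthPart_one]

theorem orthPart_apply_inv (σ : CongruenceGroup N) (x : Euc N) :
    orthPart σ (orthPart σ⁻¹ x) = x := by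
  rw [← orthPart_mul, mul_inv_cancel, orthPart_one]

theorem inner_orthPart (σ : CongruenceGroup N) (x y : Euc N) :
    inner ℝ (orthPart σ x) (orthPart σ y) = inner ℝ x y :=
  σ.linearIsometryEquiv.inner_map_map x y

theorem inner_orthPart_left (σ : CongruenceGroup N) (x y : Euc N) :
    inner ℝ (orthPart σ x) y = inner ℝ x (orthPart σ⁻¹ y) := by
  rw [← inner_orthPart σ x, orthPart_apply_inv]

theorem norm_orthPart (σ : CongruenceGroup N) (x : Euc N) : ‖orthPart σ x‖ = ‖x‖ :=
  σ.linearIsometryEquiv.norm_map x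

theorem apply_sub_apply (σ : CongruenceGroup N) (x y : Euc N) :
    σ x - σ y = orthPart σ (x - y) := by
  rw [apply_eq_orthPart_add σ x, apply_eq_orthPart_add σ y, map_sub]; abel

theorem exists_transl_of_orthPart_eq {σ τ : CongruenceGroup N}
    (h : ∀ x, orthPart σ x = orthPart τ x) : σ * τ⁻¹ = transl (σ 0 - τ 0) := by
  rw [mul_inv_eq_iff_eq_mul]
  ext1 x
  change σ x = (σ 0 - τ 0) + τ x
  rw [apply_eq_orthPart_add σ x, apply_eq_orthPart_add τ x, h]; abel

variable {G : Subgroup (CongruenceGroup N)}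

theorem apply_sub_mem_of_orthPart_eq {σ τ : CongruenceGroup N} (hσ : σ ∈ G) (hτ : τ ∈ G)
    (h : ∀ x, orthPart σ x = orthPart τ x) (x : Euc N) :
    σ x - τ x ∈ translationLattice G := by
  have e : σ x - τ x = σ 0 - τ 0 := by
    rw [apply_eq_orthPart_add σ x, apply_eq_orthPart_add τ x, h]; abel
  rw [e, mem_translationLattice, ← exists_transl_of_orthPart_eq h]
  exact G.mul_mem hσ (G.inv_mem hτ)

theorem orthPart_mem_reciprocal {σ : CongruenceGroup N} (hσ : σ ∈ G) {y : Euc N}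
    (hy : y ∈ reciprocal (translationLattice G)) :
    orthPart σ y ∈ reciprocal (translationLattice G) := by
  rw [mem_reciprocal] at *
  intro x hx
  obtain ⟨n, hn⟩ := hy _ (orthPart_mem (G.inv_mem hσ) hx)
  exact ⟨n, by rw [← hn, inner_orthPart_left, inv_inv]⟩

end orthPart

/-! ### Rotations and reflections of the plane -/

/-- `A` is a rotation of the Euclidean plane about the origin. -/
def IsRotation (A : Euc 2 →L[ℝ] Euc 2) : Prop :=
  ∃ c s : ℝ, c ^ 2 + s ^ 2 = 1 ∧
    ∀ x, A x 0 = c * x 0 - s * x 1 ∧ A x 1 = s * x 0 + c * x 1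

/-- `A` is the reflection of the Euclidean plane in a line through the origin. -/
def IsReflection (A : Euc 2 →L[ℝ] Euc 2) : Prop :=
  ∃ c s : ℝ, c ^ 2 + s ^ 2 = 1 ∧
    ∀ x, A x 0 = c * x 0 + s * x 1 ∧ A x 1 = s * x 0 - c * x 1

theorem isRotation_or_isReflection (σ : CongruenceGroup 2) :
    IsRotation (orthPart σ) ∨ IsReflection (orthPart σ) := by
  set A := orthPart σ with hA
  set e₀ : Euc 2 := !₂[1, 0] with he₀
  set e₁ : Euc 2 := !₂[0, 1] with he₁
  have h00 := inner_orthPart σ e₀ e₀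
  have h01 := inner_orthPart σ e₀ e₁
  have h11 := inner_orthPart σ e₁ e₁
  rw [← hA, inner_plane, inner_plane] at h00 h01 h11
  have hx : ∀ x, A x = x 0 • A e₀ + x 1 • A e₁ := by
    intro x
    rw [← map_smul, ← map_smul, ← map_add]
    congr 1
    exact plane_ext (by simp [he₀, he₁]) (by simp [he₀, he₁])
  generalize A e₀ = p at *
  generalize A e₁ = q at *
  simp [he₀, he₁] at h00 h01 h11
  -- Lagrange's identity: the squared determinant is `|p|²|q|² - (p·q)² = 1`.
  have hdet : (p 0 * q 1 - p 1 * q 0 - 1) * (p 0 * q 1 - p 1 * q 0 + 1) = 0 := by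
    linear_combination (q 0 * q 0 + q 1 * q 1) * h00 + h11 - (p 0 * q 0 + p 1 * q 1) * h01
  rcases mul_eq_zero.mp hdet with h | h
  · left
    have h1 : q 1 = p 0 := by linear_combination - q 1 * h00 + p 0 * h + p 1 * h01
    have h0 : q 0 = - p 1 := by linear_combination - q 0 * h00 - p 1 * h + p 0 * h01
    refine ⟨p 0, p 1, by linarith, fun x => ?_⟩
    rw [hx]
    constructor <;> simp [h0, h1] <;> ring
  · right
    have h1 : q 1 = - p 0 := by linear_combination - q 1 * h00 + p 0 * h + p 1 * h01
    have h0 : q 0 = p 1 := by linear_combination - q 0 * h00 - p 1 * h + p 0 * h01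
    refine ⟨p 0, p 1, by linarith, fun x => ?_⟩
    rw [hx]
    constructor <;> simp [h0, h1] <;> ring

theorem IsRotation.comp {A B : Euc 2 →L[ℝ] Euc 2} (hA : IsRotation A) (hB : IsRotation B) :
    IsRotation (A.comp B) := by
  obtain ⟨c, s, h, hA⟩ := hA
  obtain ⟨c', s', h', hB⟩ := hB
  refine ⟨c * c' - s * s', s * c' + c * s', ?_, fun x => ?_⟩
  · linear_combination (c' ^ 2 + s' ^ 2) * h + h'
  · simp only [ContinuousLinearMap.comp_apply, hA, hB]
    constructor <;> ring

theorem IsReflection.comp {A B : Euc 2 →L[ℝ] Euc 2} (hA : IsReflection A)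
    (hB : IsReflection B) : IsRotation (A.comp B) := by
  obtain ⟨c, s, h, hA⟩ := hA
  obtain ⟨c', s', h', hB⟩ := hB
  refine ⟨c * c' + s * s', s * c' - c * s', ?_, fun x => ?_⟩
  · linear_combination (c' ^ 2 + s' ^ 2) * h + h'
  · simp only [ContinuousLinearMap.comp_apply, hA, hB]
    constructor <;> ring

theorem IsRotation.comp_isReflection {A B : Euc 2 →L[ℝ] Euc 2} (hA : IsRotation A)
    (hB : IsReflection B) : IsReflection (A.comp B) := by
  obtain ⟨c, s, h, hA⟩ := hA
  obtain ⟨c', s', h', hB⟩ := hB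
  refine ⟨c * c' - s * s', s * c' + c * s', ?_, fun x => ?_⟩
  · linear_combination (c' ^ 2 + s' ^ 2) * h + h'
  · simp only [ContinuousLinearMap.comp_apply, hA, hB]
    constructor <;> ring

theorem IsReflection.apply_apply {A : Euc 2 →L[ℝ] Euc 2} (hA : IsReflection A) (x : Euc 2) :
    A (A x) = x := by
  obtain ⟨c, s, h, hA⟩ := hA
  apply plane_ext <;> simp only [hA]
  · linear_combination x 0 * h
  · linear_combination x 1 * h

theorem IsReflection.inner_apply {A : Euc 2 →L[ℝ] Euc 2} (hA : IsReflection A) (x y : Euc 2) :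
    inner ℝ (A x) y = inner ℝ x (A y) := by
  obtain ⟨c, s, h, hA⟩ := hA
  simp only [inner_plane, hA]
  ring

theorem IsReflection.exists_fixed {A : Euc 2 →L[ℝ] Euc 2} (hA : IsReflection A) :
    ∃ w, w ≠ 0 ∧ A w = w := by
  obtain ⟨c, s, h, hA⟩ := hA
  -- The axis is spanned by `(1 + c, s)`, except that this vector vanishes when `c = -1`.
  by_cases hc : c = -1
  · have hs : s = 0 := by subst hc; nlinarith
    refine ⟨!₂[0, 1], fun h => ?_, plane_ext ?_ ?_⟩
    · simpa using congrArg (fun x : Euc 2 => x 1) h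
    · simp [hA, hs]
    · simp [hA, hc]
  · refine ⟨!₂[1 + c, s], fun h => hc ?_, plane_ext ?_ ?_⟩
    · have : 1 + c = 0 := by simpa using congrArg (fun x : Euc 2 => x 0) h
      linarith
    · simp only [hA]; simp; linear_combination h
    · simp only [hA]; simp; ring

/-- A vector that is fixed by a rotation other than the identity vanishes. -/
theorem IsRotation.eq_self {A : Euc 2 →L[ℝ] Euc 2} (hA : IsRotation A) {w : Euc 2}
    (hw : w ≠ 0) (h : A w = w) (x : Euc 2) : A x = x := by
  obtain ⟨c, s, hcs, hA⟩ := hA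
  have h0 := (hA w).1
  have h1 := (hA w).2
  rw [h] at h0 h1
  have hp := plane_ne_zero hw
  have hc : c = 1 := by
    refine mul_left_cancel₀ hp.ne' ?_
    linear_combination - w 0 * h0 - w 1 * h1
  have hs : s = 0 := by
    refine mul_left_cancel₀ hp.ne' ?_
    linear_combination w 1 * h0 - w 0 * h1
  apply plane_ext <;> simp [hA, hc, hs]

/-- A reflection is determined by a nonzero vector on its axis. -/
theorem IsReflection.eq_of_fixed {A B : Euc 2 →L[ℝ] Euc 2} (hA : IsReflection A)
    (hB : IsReflection B) {w : Euc 2} (hw : w ≠ 0) (hAw : A w = w) (hBw : B w = w)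
    (x : Euc 2) : A x = B x := by
  have := (hA.comp hB).eq_self hw (by simp [hAw, hBw]) x
  rw [ContinuousLinearMap.comp_apply] at this
  rw [← this, hA.apply_apply, this]

/-- `A w - w` is a nonzero normal of the axis, and the hypothesis makes `l` orthogonal to it; hence
`l` lies on the axis. -/
theorem IsReflection.fixed_of_inner_eq {A : Euc 2 →L[ℝ] Euc 2} (hA : IsReflection A)
    {w l : Euc 2} (hw : A w ≠ w) (h : inner ℝ (A w) l = inner ℝ w l) : A l = l := by
  have hu := hA.apply_apply w
  obtain ⟨c, s, hcs, hA⟩ := hA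
  have hp := (plane_ne_zero (sub_ne_zero.mpr hw)).ne'
  have hneg : A (A w - w) = -(A w - w) := by rw [map_sub, hu]; abel
  have h' : inner ℝ (A w - w) l = 0 := by rw [inner_sub_left, h, sub_self]
  generalize A w - w = u at hneg h' hp
  have h0 := (hA u).1
  have h1 := (hA u).2
  rw [hneg, PiLp.neg_apply] at h0 h1
  rw [inner_plane] at h'
  apply plane_ext <;> rw [← sub_eq_zero] <;> simp only [hA] <;>
    refine (mul_eq_zero.mp ?_).resolve_left hp
  · linear_combination -2 * u 0 * h' - l 0 * (u 0 * h0 - u 1 * h1) - l 1 * (u 1 * h0 + u 0 * h1)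
  · linear_combination -2 * u 1 * h' - l 0 * (u 1 * h0 + u 0 * h1) + l 1 * (u 0 * h0 - u 1 * h1)

/-- `m + A m` is twice the orthogonal projection of `m` to the axis `ℝ l` of a reflection `A`. -/
theorem IsReflection.add_apply {A : Euc 2 →L[ℝ] Euc 2} (hA : IsReflection A) {l : Euc 2}
    (hl : l ≠ 0) (h : A l = l) (m : Euc 2) :
    m + A m = (2 * inner ℝ m l / inner ℝ l l : ℝ) • l := by
  have hp := (plane_ne_zero hl).ne'
  obtain ⟨c, s, hcs, hA⟩ := hA
  have h0 := (hA l).1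
  have h1 := (hA l).2
  rw [h] at h0 h1
  have hll : inner ℝ l l = l 0 ^ 2 + l 1 ^ 2 := by rw [inner_plane]; ring
  apply plane_ext <;> rw [PiLp.add_apply, PiLp.smul_apply, smul_eq_mul, div_mul_eq_mul_div,
    eq_div_iff (hll ▸ hp)] <;> simp only [hll, inner_plane, hA]
  · linear_combination - m 0 * (l 0 * h0 - l 1 * h1) - m 1 * (l 1 * h0 + l 0 * h1)
  · linear_combination - m 0 * (l 1 * h0 + l 0 * h1) + m 1 * (l 0 * h0 - l 1 * h1)

/-! ### Bases of planar lattices -/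

section basis

variable {Λ : Submodule ℤ (Euc 2)} {l m : Euc 2}

theorem isLatticeBasis_pair :
    IsLatticeBasis Λ ![l, m] ↔
      LinearIndependent ℝ ![l, m] ∧ ∀ y, y ∈ Λ ↔ ∃ a b : ℤ, y = a • l + b • m := by
  rw [IsLatticeBasis, Matrix.range_cons_cons_empty]
  refine and_congr_right fun _ => ⟨?_, fun h => ?_⟩
  · rintro rfl y
    simp only [Submodule.mem_span_pair, eq_comm]
  · ext y
    simp only [h, Submodule.mem_span_pair, eq_comm]

theorem IsPrimitiveVector.exists_basis (h : IsPrimitiveVector Λ l) :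
    ∃ m, IsLatticeBasis Λ ![l, m] := by
  obtain ⟨v, ⟨hv, hs⟩, i, rfl⟩ := h
  have e : ∀ u : Fin 2 → Euc 2, u = ![u 0, u 1] := fun u => by ext i; fin_cases i <;> rfl
  fin_cases i
  · exact ⟨v 1, by rw [e v] at hv hs; exact ⟨hv, hs⟩⟩
  · refine ⟨v 0, ?_, ?_⟩
    · rw [e v] at hv
      exact LinearIndependent.pair_symm_iff.mp hv
    · rw [← hs, e v]
      simp only [Matrix.range_cons_cons_empty]
      simp [Set.pair_comm]

variable (hb : IsLatticeBasis Λ ![l, m])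
include hb

theorem IsLatticeBasis.mem_iff (y : Euc 2) : y ∈ Λ ↔ ∃ a b : ℤ, y = a • l + b • m :=
  (isLatticeBasis_pair.mp hb).2 y

theorem IsLatticeBasis.left_mem : l ∈ Λ := (hb.mem_iff l).mpr ⟨1, 0, by simp⟩

theorem IsLatticeBasis.right_mem : m ∈ Λ := (hb.mem_iff m).mpr ⟨0, 1, by simp⟩

theorem IsLatticeBasis.eq_zero_of_add_eq_zero {a b : ℝ} (h : a • l + b • m = 0) :
    a = 0 ∧ b = 0 := LinearIndependent.pair_iff.mp hb.1 a b h

theorem IsLatticeBasis.left_ne_zero : l ≠ 0 := by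
  rintro rfl
  simpa using (hb.eq_zero_of_add_eq_zero (a := 1) (b := 0) (by simp)).1

theorem IsLatticeBasis.wedge_ne_zero : l 0 * m 1 - l 1 * m 0 ≠ 0 := by
  intro h
  have h0 := hb.eq_zero_of_add_eq_zero (a := m 0) (b := - l 0) (plane_ext
    (by simp; ring) (by simp; linarith))
  have h1 := hb.eq_zero_of_add_eq_zero (a := m 1) (b := - l 1) (plane_ext
    (by simp; linarith) (by simp; ring))
  refine hb.left_ne_zero (plane_ext ?_ ?_) <;> simp <;> linarith

theorem IsLatticeBasis.sub_zsmul (j : ℤ) : IsLatticeBasis Λ ![l, m - j • l] := by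
  refine isLatticeBasis_pair.mpr ⟨?_, fun y => ?_⟩
  · refine LinearIndependent.pair_iff.mpr fun a b h => ?_
    have := hb.eq_zero_of_add_eq_zero (a := a - b * j) (b := b) (by
      rw [← h, ← Int.cast_smul_eq_zsmul ℝ]; module)
    obtain ⟨h1, rfl⟩ := this
    exact ⟨by linarith, rfl⟩
  · rw [hb.mem_iff]
    constructor
    · rintro ⟨a, b, rfl⟩
      exact ⟨a + b * j, b, by module⟩
    · rintro ⟨a, b, rfl⟩
      exact ⟨a - b * j, b, by module⟩

omit hb in
theorem finite_norm_le {v : Fin 2 → Euc 2} (hb : IsLatticeBasis Λ v) (r : ℝ) :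
    {y | y ∈ Λ ∧ ‖y‖ ≤ r}.Finite := by
  have hs := hb.1.span_eq_top_of_card_eq_finrank (by simp)
  let b := Module.Basis.mk hb.1 hs.ge
  have hr : Submodule.span ℤ (Set.range b) = Λ := by rw [Module.Basis.coe_mk]; exact hb.2
  refine (ZSpan.setFinite_inter b (Metric.isBounded_closedBall (x := 0) (r := r))).subset ?_
  rintro y ⟨hy, hn⟩
  rw [hr]
  exact ⟨by simpa using hn, hy⟩

end basis

/-! ### Reflections and glide reflections whose axis contains `l` -/

section glide

variable {G : Subgroup (CongruenceGroup 2)} {l m : Euc 2}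

/-- If `l` lies on the axis of the reflection part of `σ ∈ G`, then the reciprocal lattice has an
orthogonal basis containing `l`, or all displacements by `σ` have an integral product with `l`. -/
theorem orthogonal_basis_or_integral
    (hb : IsLatticeBasis (reciprocal (translationLattice G)) ![l, m])
    {σ : CongruenceGroup 2} (hσ : σ ∈ G) (hr : IsReflection (orthPart σ))
    (hl : orthPart σ l = l) :
    (∃ l₂ ∈ reciprocal (translationLattice G), inner ℝ l l₂ = 0 ∧
      IsLatticeBasis (reciprocal (translationLattice G)) ![l, l₂]) ∨
    ∀ x, ∃ n : ℤ, inner ℝ (σ x - x) l = n := by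
  have hl0 := hb.left_ne_zero
  have hll : inner ℝ l l ≠ 0 := inner_self_ne_zero.mpr hl0
  set k : ℝ := 2 * inner ℝ m l / inner ℝ l l with hk
  have hadd : m + orthPart σ m = k • l := hr.add_apply hl0 hl m
  -- `m + A m` is a lattice vector and a multiple of the basis vector `l`, so the factor is an
  -- integer.
  obtain ⟨k', hk'⟩ : ∃ k' : ℤ, k = k' := by
    obtain ⟨a, b, hab⟩ := (hb.mem_iff _).mp (add_mem hb.right_mem
      (orthPart_mem_reciprocal hσ hb.right_mem))
    rw [hadd, ← Int.cast_smul_eq_zsmul ℝ, ← Int.cast_smul_eq_zsmul ℝ] at hab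
    have := hb.eq_zero_of_add_eq_zero (a := k - a) (b := - b) (by
      rw [sub_smul, hab]; module)
    exact ⟨a, by linarith [this.1]⟩
  -- The number `k / 2` is the coefficient of the projection of `m` to `ℝ l`; when it is an integer
  -- `j`, subtracting `j • l` from `m` leaves a vector orthogonal to `l`.
  rcases Int.even_or_odd' k' with ⟨j, hj | hj⟩
  · left
    have hb' := hb.sub_zsmul j
    refine ⟨_, hb'.right_mem, ?_, hb'⟩
    rw [inner_sub_right, ← Int.cast_smul_eq_zsmul ℝ, inner_smul_right, real_inner_comm]
    have : (j : ℝ) = inner ℝ m l / inner ℝ l l := by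
      have h2 : k = 2 * j := by rw [hk', hj]; push_cast; ring
      rw [hk] at h2
      field_simp at h2 ⊢
      linarith
    rw [this]
    field_simp
    ring
  · right
    -- `σ²` is the translation by `ν + A ν`, where `ν = σ 0`. Its products with `l` and `m` give
    -- integers `n₁ = 2⟨ν, l⟩` and `n₂ = (2j + 1)⟨ν, l⟩`, whence `⟨ν, l⟩ = n₂ - j n₁`.
    have hν : σ 0 + orthPart σ (σ 0) ∈ translationLattice G := by
      have := apply_sub_mem_of_orthPart_eq (G.mul_mem hσ hσ) G.one_mem
        (fun x => by rw [orthPart_mul, hr.apply_apply, orthPart_one]) 0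
      have e : (σ * σ) 0 - (1 : CongruenceGroup 2) 0 = σ 0 + orthPart σ (σ 0) := by
        change σ (σ 0) - 0 = _
        rw [sub_zero, apply_eq_orthPart_add σ (σ 0), add_comm]
      rwa [e] at this
    obtain ⟨n₁, h₁⟩ := mem_reciprocal.mp hb.left_mem _ hν
    obtain ⟨n₂, h₂⟩ := mem_reciprocal.mp hb.right_mem _ hν
    rw [inner_add_left, hr.inner_apply, hl] at h₁
    rw [inner_add_left, hr.inner_apply, ← inner_add_right, hadd, inner_smul_right, hk', hj] at h₂
    intro x
    refine ⟨n₂ - j * n₁, ?_⟩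
    rw [apply_eq_orthPart_add σ x, inner_sub_left, inner_add_left, hr.inner_apply, hl]
    push_cast at h₂ ⊢
    linear_combination h₂ - j * h₁

end glide

theorem inv_mul_mem_translationSubgroup {N : ℕ} {G : Subgroup (CongruenceGroup N)} {σ τ : G}
    (h : ∀ x, orthPart (σ : CongruenceGroup N) x = orthPart (τ : CongruenceGroup N) x) :
    σ⁻¹ * τ ∈ translationSubgroup G := by
  refine ⟨(σ : CongruenceGroup N)⁻¹ 0 - (τ : CongruenceGroup N)⁻¹ 0, ?_⟩
  rw [← exists_transl_of_orthPart_eq fun x => ?_]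
  · simp
  · conv_lhs => rw [← orthPart_apply_inv (τ : CongruenceGroup N) x, ← h]
    exact orthPart_inv_apply _ _

/-! ### Duality between `L` and its reciprocal; finiteness of `G / L` -/

section lattice

variable {G : Subgroup (CongruenceGroup 2)} {v : Fin 2 → Euc 2}
  (hb : IsLatticeBasis (reciprocal (translationLattice G)) v)
include hb

/-- A nonzero vector orthogonal to `L` would put a whole line into the reciprocal lattice, which has
only finitely many points in each ball. -/
theorem span_translationLattice : Submodule.span ℝ (translationLattice G : Set (Euc 2)) = ⊤ := by
  by_contra hne
  obtain ⟨y, hy, hy0⟩ := Submodule.exists_mem_ne_zero_of_ne_bot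
    (mt (Submodule.orthogonal_eq_bot_iff).mp hne)
  have hmem : ∀ t : ℝ, t • y ∈ reciprocal (translationLattice G) := fun t =>
    mem_reciprocal.mpr fun x hx => ⟨0, by
      rw [inner_smul_right, (Submodule.mem_orthogonal _ _).mp hy x (Submodule.subset_span hx)]
      simp⟩
  have hfin := finite_norm_le hb ‖y‖
  refine (Set.Icc_infinite (zero_lt_one (α := ℝ))).image (f := fun t : ℝ => t • y)
    (smul_left_injective ℝ hy0).injOn (hfin.subset ?_)
  rintro _ ⟨t, ht, rfl⟩
  refine ⟨hmem t, ?_⟩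
  rw [norm_smul, Real.norm_of_nonneg ht.1]
  exact mul_le_of_le_one_left (norm_nonneg _) ht.2

omit hb in
theorem nondegenerate_inner : (innerₗ (Euc 2) : LinearMap.BilinForm ℝ (Euc 2)).Nondegenerate := by
  refine ⟨fun x hx => ?_, fun x hx => ?_⟩ <;> exact inner_self_eq_zero.mp (hx x)

/-- `L` lies in its double dual, which is spanned by the dual of a basis of the reciprocal lattice.
This is where discreteness of `L` comes from. -/
theorem exists_basis_le : ∃ b : Module.Basis (Fin 2) ℝ (Euc 2),
    translationLattice G ≤ Submodule.span ℤ (Set.range b) := by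
  have hs := hb.1.span_eq_top_of_card_eq_finrank (by simp)
  let b := Module.Basis.mk hb.1 hs.ge
  have hr : Submodule.span ℤ (Set.range b) = reciprocal (translationLattice G) := by
    rw [Module.Basis.coe_mk]; exact hb.2
  refine ⟨LinearMap.BilinForm.dualBasis _ nondegenerate_inner b, ?_⟩
  rw [← LinearMap.BilinForm.dualSubmodule_span_of_basis, hr]
  intro x hx
  refine (mem_reciprocal (Λ := reciprocal _)).mpr fun y hy => ?_
  obtain ⟨n, hn⟩ := mem_reciprocal.mp hy x hx
  exact ⟨n, by rw [real_inner_comm, hn]⟩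

/-- Multiplication by `n` maps `L₂` injectively and continuously into a discrete lattice. The case
`n = 1` is `L` itself; larger `n` serves the overlattices that contradict `DetectsLattice`. -/
theorem discreteTopology_of_nsmul_mem {L₂ : Submodule ℤ (Euc 2)} {n : ℕ} (hn : n ≠ 0)
    (h : ∀ x ∈ L₂, n • x ∈ translationLattice G) : DiscreteTopology L₂ := by
  obtain ⟨b, hle⟩ := exists_basis_le hb
  refine DiscreteTopology.of_continuous_injective
    (f := fun x : L₂ => (⟨n • (x : Euc 2), hle (h x x.2)⟩ : Submodule.span ℤ (Set.range b)))
    (by fun_prop) fun x y hxy => ?_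
  have hxy' : n • (x : Euc 2) = n • (y : Euc 2) := congrArg Subtype.val hxy
  rw [← Nat.cast_smul_eq_nsmul ℝ, ← Nat.cast_smul_eq_nsmul ℝ] at hxy'
  exact Subtype.ext (smul_right_injective _ (Nat.cast_ne_zero.mpr hn) hxy')

/-- `L` is a full lattice, so it equals its double dual. -/
theorem mem_translationLattice_of_inner {x : Euc 2}
    (h : ∀ i, ∃ n : ℤ, inner ℝ x (v i) = n) : x ∈ translationLattice G := by
  have hd : DiscreteTopology (translationLattice G) :=
    discreteTopology_of_nsmul_mem hb one_ne_zero (by simp)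
  have hz : IsZLattice ℝ (translationLattice G) := ⟨span_translationLattice hb⟩
  have : Module.Finite ℤ (translationLattice G) := ZLattice.module_finite ℝ _
  have : Module.Free ℤ (translationLattice G) := ZLattice.module_free ℝ _
  let b := (Module.Free.chooseBasis ℤ (translationLattice G)).ofZLatticeBasis ℝ
  have hspan : Submodule.span ℤ (Set.range b) = translationLattice G :=
    Module.Basis.ofZLatticeBasis_span ℝ _ _
  have hdual := LinearMap.BilinForm.dualSubmodule_dualSubmodule_of_basis (R := ℤ)
    (B := innerₗ (Euc 2)) nondegenerate_inner ⟨fun x y => real_inner_comm y x⟩ b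
  rw [hspan] at hdual
  rw [← hdual]
  change x ∈ reciprocal (reciprocal _)
  rw [mem_reciprocal, ← hb.2]
  intro y hy
  induction hy using Submodule.span_induction with
  | mem y hy =>
    obtain ⟨i, rfl⟩ := hy
    obtain ⟨n, hn⟩ := h i
    exact ⟨n, by rw [real_inner_comm, hn]⟩
  | zero => exact ⟨0, by simp⟩
  | add y z _ _ hy hz =>
    obtain ⟨a, ha⟩ := hy
    obtain ⟨b, hb⟩ := hz
    exact ⟨a + b, by rw [inner_add_left, ha, hb]; push_cast; rfl⟩
  | smul k y _ hy =>
    obtain ⟨a, ha⟩ := hy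
    exact ⟨k * a, by
      rw [← Int.cast_smul_eq_zsmul ℝ, real_inner_smul_left, ha]; push_cast; rfl⟩

/-- A class in `G / L` is determined by its orthogonal part, hence by the images of the two basis
vectors of the reciprocal lattice; as norms are preserved, these images range over a finite set. -/
theorem finite_quotient : Finite (G ⧸ translationSubgroup G) := by
  have hs := hb.1.span_eq_top_of_card_eq_finrank (by simp)
  have hf := finite_norm_le hb (‖v 0‖ + ‖v 1‖)
  have := hf.to_subtype
  have hv : ∀ i, v i ∈ reciprocal (translationLattice G) := fun i =>
    hb.2 ▸ Submodule.subset_span ⟨i, rfl⟩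
  let f : G ⧸ translationSubgroup G → Fin 2 →
      {y | y ∈ reciprocal (translationLattice G) ∧ ‖y‖ ≤ ‖v 0‖ + ‖v 1‖} := fun q i =>
    ⟨orthPart (q.out : CongruenceGroup 2) (v i), orthPart_mem_reciprocal q.out.2 (hv i), by
      rw [norm_orthPart]
      fin_cases i
      · exact le_add_of_nonneg_right (norm_nonneg _)
      · exact le_add_of_nonneg_left (norm_nonneg _)⟩
  refine Finite.of_injective f fun q q' h => ?_
  have heq : orthPart (q.out : CongruenceGroup 2) = orthPart (q'.out : CongruenceGroup 2) := by
    refine ContinuousLinearMap.coe_injective (LinearMap.ext_on_range hs fun i => ?_)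
    exact congrArg Subtype.val (congrFun h i)
  rw [← q.out_eq', ← q'.out_eq']
  exact QuotientGroup.eq.mpr (inv_mul_mem_translationSubgroup fun x => by rw [heq])

end lattice

/-! ### Characters of real vector spaces and their independence -/

/-- The character `r ↦ exp(-2π√-1 r)` of the real line. -/
noncomputable def phase (r : ℝ) : ℂ := Complex.exp (-2 * Real.pi * Complex.I * r)

theorem phase_ne_zero (r : ℝ) : phase r ≠ 0 := Complex.exp_ne_zero _

theorem phase_zero : phase 0 = 1 := by simp [phase]

theorem phase_add (r s : ℝ) : phase (r + s) = phase r * phase s := by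
  rw [phase, phase, phase, ← Complex.exp_add]; push_cast; ring_nf

theorem phase_eq_one_iff {r : ℝ} : phase r = 1 ↔ ∃ n : ℤ, r = n := by
  rw [phase, Complex.exp_eq_one_iff]
  have hpi : (2 * Real.pi * Complex.I : ℂ) ≠ 0 := Complex.two_pi_I_ne_zero
  constructor
  · rintro ⟨n, hn⟩
    refine ⟨-n, ?_⟩
    have : (r : ℂ) = ((-n : ℤ) : ℂ) := by
      refine mul_left_cancel₀ hpi ?_
      push_cast
      linear_combination -hn
    exact_mod_cast this
  · rintro ⟨n, rfl⟩
    exact ⟨-n, by push_cast; ring⟩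

theorem phase_eq_phase_iff {r s : ℝ} : phase r = phase s ↔ ∃ n : ℤ, r - s = n := by
  rw [← phase_eq_one_iff]
  have h := phase_add (r - s) s
  rw [sub_add_cancel] at h
  rw [h]
  exact mul_eq_right₀ (phase_ne_zero s)

/-- The `χ i` may repeat: after collecting equal ones, this is Dedekind's independence of
characters. -/
theorem sum_coeff_eq_zero_of_monoidHom {ι M : Type*} [Fintype ι] [Monoid M] (c : ι → ℂ)
    (χ : ι → M →* ℂ) (h : ∀ u, ∑ i, c i * χ i u = 0) (j : ι) [DecidableEq (M →* ℂ)] :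
    ∑ i with χ i = χ j, c i = 0 := by
  have hli := linearIndependent_iff'.mp (linearIndependent_monoidHom M ℂ)
    (Finset.univ.image χ) (fun f => ∑ i with χ i = f, c i) ?_ (χ j) (by simp)
  · exact hli
  · ext u
    rw [Finset.sum_apply, Pi.zero_apply, ← h u,
      ← Finset.sum_fiberwise_of_maps_to (t := Finset.univ.image χ) (g := χ) (by simp)]
    refine Finset.sum_congr rfl fun f _ => ?_
    rw [Pi.smul_apply, smul_eq_mul, Finset.sum_mul]
    refine Finset.sum_congr rfl fun i hi => ?_
    rw [(Finset.mem_filter.mp hi).2]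

/-- The character `u ↦ exp(-2π√-1 f(u))` of a real vector space. -/
noncomputable def phaseHom {E : Type*} [AddCommGroup E] [Module ℝ E] (f : E →ₗ[ℝ] ℝ) :
    Multiplicative E →* ℂ where
  toFun u := phase (f u.toAdd)
  map_one' := by simp [phase_zero]
  map_mul' u v := by simp [phase_add]

/-- If `f u ≠ g u`, rescale `u` so that the difference becomes `1/2`, which is not an integer. -/
theorem phaseHom_injective {E : Type*} [AddCommGroup E] [Module ℝ E] :
    Function.Injective (phaseHom (E := E)) := by
  intro f g h
  ext u
  by_contra hne
  have hd : f u - g u ≠ 0 := sub_ne_zero.mpr hne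
  obtain ⟨n, hn⟩ := phase_eq_phase_iff.mp
    (DFunLike.congr_fun h (Multiplicative.ofAdd ((2 * (f u - g u))⁻¹ • u)))
  simp only [toAdd_ofAdd, map_smul, smul_eq_mul] at hn
  have h2 : (2 * n : ℝ) = 1 := by
    rw [← hn]; field_simp
  have h3 : 2 * n = 1 := by exact_mod_cast h2
  omega

/-! ### Vanishing of the structure factor along a component of the fixed set -/

section component

variable {N : ℕ} {G : Subgroup (CongruenceGroup N)} {H : Subgroup G}

theorem orthPart_transl (ν x : Euc N) : orthPart (transl ν) x = x := by
  have h := apply_eq_orthPart_add (transl ν) x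
  rw [transl_apply, transl_apply, add_zero, add_comm] at h
  exact (add_right_cancel h).symm

theorem mk_mem_fixedPoints {x : Euc N} :
    (Submodule.Quotient.mk x : TorusOf G) ∈ MulAction.fixedPoints H (TorusOf G) ↔
      ∀ h ∈ H, (h : CongruenceGroup N) x - x ∈ translationLattice G := by
  rw [MulAction.mem_fixedPoints, Subtype.forall]
  refine forall₂_congr fun h hh => ?_
  change h • (Submodule.Quotient.mk x : TorusOf G) = _ ↔ _
  rw [smul_mk_torus, Submodule.Quotient.eq]

/-- The vectors that are fixed by the orthogonal parts of all elements of `H`. -/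
def fixedDirections (H : Subgroup G) : Submodule ℝ (Euc N) where
  carrier := {u | ∀ h ∈ H, orthPart (h : CongruenceGroup N) u = u}
  add_mem' ha hb h hh := by rw [map_add, ha h hh, hb h hh]
  zero_mem' h hh := map_zero _
  smul_mem' t a ha h hh := by rw [map_smul, ha h hh]

/-- The image of `x + fixedDirections H` is connected, being a continuous image of a subspace, and
`H` fixes it pointwise. -/
theorem mk_add_mem_component {x u : Euc N}
    (hx : (Submodule.Quotient.mk x : TorusOf G) ∈ MulAction.fixedPoints H (TorusOf G))
    (hu : u ∈ fixedDirections H) :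
    (Submodule.Quotient.mk (x + u) : TorusOf G) ∈
      connectedComponentIn (MulAction.fixedPoints H (TorusOf G)) (Submodule.Quotient.mk x) := by
  let f : Euc N → TorusOf G := fun u => Submodule.Quotient.mk (x + u)
  have hf : Continuous f := continuous_quot_mk.comp (continuous_const.add continuous_id)
  have hc : IsPreconnected (f '' (fixedDirections H : Set (Euc N))) :=
    (fixedDirections H).convex.isPreconnected.image f hf.continuousOn
  refine hc.subset_connectedComponentIn ⟨0, zero_mem _, ?_⟩ ?_ ⟨u, hu, rfl⟩
  · simp [f]
  · rintro _ ⟨w, hw, rfl⟩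
    refine mk_mem_fixedPoints.mpr fun h hh => ?_
    rw [← sub_add_sub_cancel _ ((h : CongruenceGroup N) x)]
    have : (h : CongruenceGroup N) (x + w) - (h : CongruenceGroup N) x = w := by
      rw [apply_sub_apply, add_sub_cancel_left, hw h hh]
    rw [this]
    convert mk_mem_fixedPoints.mp hx h hh using 1
    abel

theorem structureTerm_mk (l : reciprocal (translationLattice G)) (x : Euc N)
    (q : G ⧸ translationSubgroup G) :
    structureTerm l (Submodule.Quotient.mk x) q =
      phase (inner ℝ ((q.out : CongruenceGroup N) x) (l : Euc N)) := by
  conv_lhs => rw [← q.out_eq']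
  change torusChar l (q.out • (Submodule.Quotient.mk x : TorusOf G)) = _
  rw [smul_mk_torus, torusChar_mk, phase]

theorem exists_nonintegral_of_gammaExt [Finite (G ⧸ translationSubgroup G)] {x l : Euc N}
    (hx : (Submodule.Quotient.mk x : TorusOf G) ∈ MulAction.fixedPoints H (TorusOf G))
    (hl : l ∈ gammaExt G (connectedComponentIn (MulAction.fixedPoints H (TorusOf G))
      (Submodule.Quotient.mk x))) :
    ∃ σ ∈ G, (∀ u ∈ fixedDirections H, inner ℝ (orthPart σ u) l = inner ℝ u l) ∧
      ¬ ∃ n : ℤ, inner ℝ (σ x - x) l = n := by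
  classical
  have := Fintype.ofFinite (G ⧸ translationSubgroup G)
  obtain ⟨hl', hU⟩ := hl
  by_contra! hcon
  let f : G ⧸ translationSubgroup G → fixedDirections H →ₗ[ℝ] ℝ := fun q =>
    (innerₗ (Euc N) l) ∘ₗ (orthPart (q.out : CongruenceGroup N)).toLinearMap ∘ₗ
      (fixedDirections H).subtype
  have hsum := sum_coeff_eq_zero_of_monoidHom
    (fun q : G ⧸ translationSubgroup G => phase (inner ℝ ((q.out : CongruenceGroup N) x) l))
    (fun q => phaseHom (f q)) (fun u => ?_) (QuotientGroup.mk 1)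
  -- If all products were integral, the surviving coefficients would all equal `phase ⟨x, l⟩`; their
  -- sum is then this nonzero number times the number of classes, which is positive because the
  -- class of `1` is counted.
  · rw [Finset.sum_congr rfl (g := fun _ => phase (inner ℝ x l)) fun q hq => ?_] at hsum
    · rw [Finset.sum_const, nsmul_eq_mul, mul_eq_zero, Nat.cast_eq_zero,
        or_iff_left (phase_ne_zero _), Finset.card_eq_zero] at hsum
      exact (Finset.filter_eq_empty_iff.mp hsum) (Finset.mem_univ _) rfl
    · have hq' := phaseHom_injective (Finset.mem_filter.mp hq).2
      have hfix : ∀ u ∈ fixedDirections H,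
          inner ℝ (orthPart (q.out : CongruenceGroup N) u) l = inner ℝ u l := by
        intro u hu
        have h1 := LinearMap.congr_fun hq' ⟨u, hu⟩
        -- The chosen representative of the class of `1` need not be `1`, but it is a translation
        -- and so has trivial orthogonal part.
        obtain ⟨ν, hν⟩ : (1 : G)⁻¹ * (QuotientGroup.mk 1 : G ⧸ translationSubgroup G).out ∈
            translationSubgroup G := QuotientGroup.eq.mp (Quotient.out_eq' _).symm
        rw [inv_one, one_mul] at hν
        simp only [f, LinearMap.comp_apply, hν, Submodule.subtype_apply,
          ContinuousLinearMap.coe_coe, orthPart_transl, innerₗ_apply_apply] at h1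
        rw [real_inner_comm, h1, real_inner_comm]
      obtain ⟨n, hn⟩ := hcon q.out q.out.2 hfix
      exact phase_eq_phase_iff.mpr ⟨n, by rw [← hn, inner_sub_left]⟩
  · have h := hU (mk_add_mem_component hx u.toAdd.2)
    change ∑ᶠ q, _ = (0 : ℂ) at h
    rw [finsum_eq_sum_of_fintype] at h
    rw [← h]
    refine Finset.sum_congr rfl fun q _ => ?_
    rw [structureTerm_mk]
    change phase _ * phase _ = _
    rw [← phase_add]
    congr 1
    simp only [f, LinearMap.comp_apply, Submodule.subtype_apply, ContinuousLinearMap.coe_coe,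
      innerₗ_apply_apply]
    rw [real_inner_comm, ← inner_add_right, real_inner_comm]
    congr 1
    rw [apply_eq_orthPart_add _ (x + _), map_add, apply_eq_orthPart_add _ x]
    abel

end component

/-! ### Groups `H` without proper rotations -/

/-- The case in which no element of `H` acts as a proper rotation. -/
theorem orthogonal_basis_of_no_rotation {G : Subgroup (CongruenceGroup 2)} {H : Subgroup G}
    {x l m : Euc 2} (hb : IsLatticeBasis (reciprocal (translationLattice G)) ![l, m])
    (hx : (Submodule.Quotient.mk x : TorusOf G) ∈ MulAction.fixedPoints H (TorusOf G))
    (hl : l ∈ gammaExt G (connectedComponentIn (MulAction.fixedPoints H (TorusOf G))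
      (Submodule.Quotient.mk x)))
    (hrot : ∀ h ∈ H, IsRotation (orthPart (h : CongruenceGroup 2)) →
      ∀ u, orthPart (h : CongruenceGroup 2) u = u) :
    ∃ l₂ ∈ reciprocal (translationLattice G), inner ℝ l l₂ = 0 ∧
      IsLatticeBasis (reciprocal (translationLattice G)) ![l, l₂] := by
  have := finite_quotient hb
  obtain ⟨σ, hσ, hfix, hint⟩ := exists_nonintegral_of_gammaExt hx hl
  have hrefl : ∀ σ ∈ G, IsReflection (orthPart σ) → orthPart σ l = l →
      (∃ l₂ ∈ reciprocal (translationLattice G), inner ℝ l l₂ = 0 ∧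
        IsLatticeBasis (reciprocal (translationLattice G)) ![l, l₂]) ∨
      ∃ n : ℤ, inner ℝ (σ x - x) l = n := fun σ hσ hr hl =>
    (orthogonal_basis_or_integral hb hσ hr hl).imp_right fun h => h x
  by_cases hH : ∃ h ∈ H, IsReflection (orthPart (h : CongruenceGroup 2))
  · obtain ⟨h, hh, hr⟩ := hH
    obtain ⟨w, hw, hhw⟩ := hr.exists_fixed
    have hfw : w ∈ fixedDirections H := by
      intro k hk
      rcases isRotation_or_isReflection (k : CongruenceGroup 2) with hk' | hk'
      · exact hrot k hk hk' w
      -- The product of two reflections is a rotation in `H`, hence trivial, so `k` fixes `w`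
      -- because `h` does.
      · have := hrot (k * h) (H.mul_mem hk hh) (hk'.comp hr) w
        rwa [Subgroup.coe_mul, orthPart_mul, hhw] at this
    have key : ∀ σ ∈ G, IsReflection (orthPart σ) → inner ℝ (orthPart σ w) l = inner ℝ w l →
        (∃ l₂ ∈ reciprocal (translationLattice G), inner ℝ l l₂ = 0 ∧
          IsLatticeBasis (reciprocal (translationLattice G)) ![l, l₂]) ∨
        ∃ n : ℤ, inner ℝ (σ x - x) l = n := by
      intro σ hσ hr' hin
      by_cases hσw : orthPart σ w = w
      · right
        -- With a common axis, `σ` and `h` have the same orthogonal part and differ by a lattice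
        -- translation, while `h` fixes `x` modulo `L`.
        have h1 := apply_sub_mem_of_orthPart_eq hσ h.2 (hr'.eq_of_fixed hr hw hσw hhw) x
        have h2 := add_mem h1 (mk_mem_fixedPoints.mp hx h hh)
        rw [sub_add_sub_cancel] at h2
        exact mem_reciprocal.mp hb.left_mem _ h2
      · exact hrefl σ hσ hr' (hr'.fixed_of_inner_eq hσw hin)
    rcases isRotation_or_isReflection σ with hσ' | hσ'
    -- Composing with `h` turns a rotation into a reflection; since `h` fixes `w` and fixes `x`
    -- modulo `L`, neither the pairing on `w` nor the integrality of the displacement changes.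
    · have hin : inner ℝ (orthPart (σ * (h : CongruenceGroup 2)) w) l = inner ℝ w l := by
        rw [orthPart_mul, hhw, hfix w hfw]
      rcases key (σ * (h : CongruenceGroup 2)) (G.mul_mem hσ h.2) (hσ'.comp_isReflection hr) hin with h1 | ⟨n, hn⟩
      · exact h1
      · have h2 : σ ((h : CongruenceGroup 2) x) - σ x ∈ translationLattice G := by
          rw [apply_sub_apply]
          exact orthPart_mem hσ (mk_mem_fixedPoints.mp hx h hh)
        obtain ⟨k, hk⟩ := mem_reciprocal.mp hb.left_mem _ h2
        refine absurd ⟨n - k, ?_⟩ hint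
        push_cast
        rw [← hn, ← hk, ← inner_sub_left]
        congr 1
        change _ = (σ ((h : CongruenceGroup 2) x) - x) - _
        abel
    · exact (key σ hσ hσ' (hfix w hfw)).resolve_right hint
  · push Not at hH
    have hall : ∀ u, u ∈ fixedDirections H := fun u h hh =>
      hrot h hh ((isRotation_or_isReflection _).resolve_right (hH h hh)) u
    have hσl : orthPart σ l = l := by
      have h1 := hfix _ (hall (orthPart σ⁻¹ l))
      rw [orthPart_apply_inv, inner_orthPart_left, inv_inv] at h1
      refine sub_eq_zero.mp (inner_self_eq_zero (𝕜 := ℝ).mp ?_)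
      rw [inner_sub_left, inner_sub_right, inner_sub_right, inner_orthPart,
        real_inner_comm l (orthPart σ l), ← h1]
      ring
    rcases isRotation_or_isReflection σ with hσ' | hσ'
    · have h1 := apply_sub_mem_of_orthPart_eq hσ G.one_mem
        (fun y => hσ'.eq_self hb.left_ne_zero hσl y) x
      exact absurd (mem_reciprocal.mp hb.left_mem _ h1) hint
    · exact (hrefl σ hσ hσ' hσl).resolve_right hint

/-! ### Characters of the torus and orbit sums -/

section character

variable {N : ℕ} {G : Subgroup (CongruenceGroup N)}

theorem torusChar_mk_eq_phase (l : reciprocal (translationLattice G)) (x : Euc N) :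
    torusChar l (Submodule.Quotient.mk x : TorusOf G) = phase (inner ℝ x (l : Euc N)) := rfl

theorem torusChar_zero (l : reciprocal (translationLattice G)) :
    torusChar l (0 : TorusOf G) = 1 := by
  rw [← Submodule.Quotient.mk_zero, torusChar_mk_eq_phase, inner_zero_left, phase_zero]

theorem torusChar_add (l : reciprocal (translationLattice G)) (v w : TorusOf G) :
    torusChar l (v + w) = torusChar l v * torusChar l w := by
  obtain ⟨x, rfl⟩ := Submodule.Quotient.mk_surjective _ v
  obtain ⟨y, rfl⟩ := Submodule.Quotient.mk_surjective _ w
  rw [← Submodule.Quotient.mk_add, torusChar_mk_eq_phase, torusChar_mk_eq_phase,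
    torusChar_mk_eq_phase, inner_add_left, phase_add]

theorem torusChar_ne_zero (l : reciprocal (translationLattice G)) (v : TorusOf G) :
    torusChar l v ≠ 0 := by
  obtain ⟨x, rfl⟩ := Submodule.Quotient.mk_surjective _ v
  exact phase_ne_zero _

theorem torusChar_neg_eq_one {l : reciprocal (translationLattice G)} {v : TorusOf G}
    (h : torusChar l v = 1) : torusChar l (-v) = 1 := by
  have := torusChar_add l (-v) v
  rwa [neg_add_cancel, torusChar_zero, h, mul_one, eq_comm] at this

theorem torusChar_nsmul (l : reciprocal (translationLattice G)) (n : ℕ) (v : TorusOf G) :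
    torusChar l (n • v) = torusChar l v ^ n := by
  induction n with
  | zero => rw [zero_smul, torusChar_zero, pow_zero]
  | succ n ih => rw [succ_nsmul, torusChar_add, ih, pow_succ]

theorem continuous_torusChar (l : reciprocal (translationLattice G)) :
    Continuous (torusChar l : TorusOf G → ℂ) := by
  refine Continuous.quotient_liftOn' ?_ _
  fun_prop

theorem structureTerm_eq_torusChar (l : reciprocal (translationLattice G)) (v : TorusOf G)
    (q : G ⧸ translationSubgroup G) : structureTerm l v q = torusChar l (q.out • v) := by
  conv_lhs => rw [← q.out_eq']
  rfl

/-- The displacements of `v` by the elements of `G`. -/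
noncomputable def orbitDisplacements [Fintype (G ⧸ translationSubgroup G)] (v : TorusOf G) :
    Finset (TorusOf G) :=
  open Classical in Finset.univ.image fun q : G ⧸ translationSubgroup G => q.out • v - v

theorem out_mk_smul (σ : G) (v : TorusOf G) :
    (QuotientGroup.mk σ : G ⧸ translationSubgroup G).out • v = σ • v := by
  have h : σ⁻¹ * (QuotientGroup.mk σ : G ⧸ translationSubgroup G).out ∈
      translationSubgroup G := QuotientGroup.eq.mp (Quotient.out_eq' _).symm
  have h' := translation_smul h v
  rw [mul_smul, inv_smul_eq_iff] at h'
  exact h'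

theorem out_smul_smul (g : G) (q : G ⧸ translationSubgroup G) (v : TorusOf G) :
    (g • q).out • v = g • q.out • v := by
  obtain ⟨σ, rfl⟩ := QuotientGroup.mk_surjective q
  rw [out_mk_smul σ, ← mul_smul, ← out_mk_smul (g * σ)]
  rfl

variable [Fintype (G ⧸ translationSubgroup G)]

theorem zero_mem_orbitDisplacements (v : TorusOf G) : 0 ∈ orbitDisplacements v := by
  classical
  refine Finset.mem_image.mpr ⟨QuotientGroup.mk 1, Finset.mem_univ _, ?_⟩
  rw [out_mk_smul, one_smul, sub_self]

theorem exists_smul_sub_of_mem_orbitDisplacements {v p : TorusOf G}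
    (hp : p ∈ orbitDisplacements v) : ∃ σ : G, p = σ • v - v := by
  classical
  obtain ⟨q, -, rfl⟩ := Finset.mem_image.mp hp
  exact ⟨_, rfl⟩

/-- The structure factor vanishes if and only if the sum over the orbit vanishes. -/
theorem mem_vanishingSet_iff (l : reciprocal (translationLattice G)) (v : TorusOf G) :
    v ∈ vanishingSet l ↔ ∑ p ∈ orbitDisplacements v, torusChar l p = 0 := by
  classical
  let f : G ⧸ translationSubgroup G → TorusOf G := fun q => q.out • v - v
  -- All fibres of the orbit map have the same size: left multiplication by `q₂.out * q₁.out⁻¹`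
  -- carries one fibre injectively into the other.
  have hle : ∀ q₁ q₂, Finset.card {q | f q = f q₁} ≤ Finset.card {q | f q = f q₂} := by
    intro q₁ q₂
    refine Finset.card_le_card_of_injOn (fun q => (q₂.out * q₁.out⁻¹) • q) (fun q hq => ?_)
      (MulAction.injective _).injOn
    have hq' : q.out • v = q₁.out • v := sub_left_injective (Finset.mem_filter.mp hq).2
    refine Finset.mem_coe.mpr (Finset.mem_filter.mpr ⟨Finset.mem_univ _, ?_⟩)
    change _ - v = _ - v
    rw [out_smul_smul, hq', mul_smul, inv_smul_smul]
  have hsum : ∑ᶠ q : G ⧸ translationSubgroup G, structureTerm l v q =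
      torusChar l v * (Finset.card {q | f q = f (QuotientGroup.mk 1)} *
        ∑ p ∈ orbitDisplacements v, torusChar l p) := by
    rw [finsum_eq_sum_of_fintype,
      Finset.sum_congr rfl (g := fun q => torusChar l v * torusChar l (f q)) fun q _ => ?_]
    · rw [← Finset.mul_sum, Finset.sum_comp (torusChar l) f]
      congr 1
      rw [Finset.mul_sum]
      refine Finset.sum_congr rfl fun p hp => ?_
      obtain ⟨q, -, rfl⟩ := Finset.mem_image.mp hp
      rw [nsmul_eq_mul, le_antisymm (hle q _) (hle _ q)]
    · rw [structureTerm_eq_torusChar, ← torusChar_add, add_sub_cancel]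
  change ∑ᶠ q : G ⧸ translationSubgroup G, structureTerm l v q = 0 ↔ _
  rw [hsum, mul_eq_zero, or_iff_right (torusChar_ne_zero _ _), mul_eq_zero, or_iff_right]
  rw [Nat.cast_eq_zero, Finset.card_eq_zero]
  exact fun h => Finset.filter_eq_empty_iff.mp h (Finset.mem_univ _) rfl

end character

/-! ### Vanishing character sums over subsets of small groups -/

section charactersum

variable {A : Type*} [AddCommGroup A] {χ : A → ℂ} (hadd : ∀ a b, χ (a + b) = χ a * χ b)
  {P : Finset A}
include hadd

/-- Translation by `a` permutes the finite set `P`, so the sum is multiplied by `χ a` and yet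
unchanged. -/
theorem eq_one_of_sum_ne_zero (hP : ∀ a ∈ P, ∀ b ∈ P, a + b ∈ P) (hs : ∑ p ∈ P, χ p ≠ 0)
    {a : A} (ha : a ∈ P) : χ a = 1 := by
  have hmap : P.map (addLeftEmbedding a) = P := by
    refine Finset.eq_of_subset_of_card_le (fun p hp => ?_) (Finset.card_map _).ge
    obtain ⟨b, hb, rfl⟩ := Finset.mem_map.mp hp
    exact hP a ha b hb
  have h := congrArg (fun Q => ∑ p ∈ Q, χ p) hmap
  simp only [Finset.sum_map, addLeftEmbedding_apply, hadd, ← Finset.mul_sum] at h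
  exact (mul_eq_right₀ hs).mp h

variable (h0 : χ 0 = 1) (hP0 : 0 ∈ P) {M : Set A} (hM : M.Finite) (hPM : ↑P ⊆ M)
  (hs : ∑ p ∈ P, χ p = 0)
include h0 hP0 hM hPM hs

/-- If closure failed at `a, b`, the bound 4 would force `P = {0, a, b}`; but `1 ± 1 ± 1` is never
zero. -/
theorem add_mem_of_sum_eq_zero_of_two_torsion (hadd_mem : ∀ a ∈ M, ∀ b ∈ M, a + b ∈ M)
    (h2 : ∀ a ∈ M, a + a = 0) (hcard : M.ncard ≤ 4) : ∀ a ∈ P, ∀ b ∈ P, a + b ∈ P := by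
  classical
  intro a ha b hb
  by_contra hab
  have ha0 : a ≠ 0 := fun h => hab (by rwa [h, zero_add])
  have hb0 : b ≠ 0 := fun h => hab (by rwa [h, add_zero])
  have hne : a ≠ b := fun h => hab (by rwa [h, h2 b (hPM hb)])
  have hle : (insert (a + b) P).card ≤ 4 := by
    rw [← Set.ncard_coe_finset]
    refine (Set.ncard_le_ncard ?_ hM).trans hcard
    rw [Finset.coe_insert, Set.insert_subset_iff]
    exact ⟨hadd_mem a (hPM ha) b (hPM hb), hPM⟩
  rw [Finset.card_insert_of_notMem hab] at hle
  have hPeq : {0, a, b} = P := by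
    refine Finset.eq_of_subset_of_card_le ?_ ?_
    · simp [Finset.insert_subset_iff, hP0, ha, hb]
    · rw [Finset.card_eq_three.mpr ⟨0, a, b, ha0.symm, hb0.symm, hne, rfl⟩]
      omega
  have hsq : ∀ a ∈ M, χ a = 1 ∨ χ a = -1 := fun a ha => by
    exact mul_self_eq_one_iff.mp (by rw [← hadd, h2 a ha, h0])
  rw [← hPeq, Finset.sum_insert (by simp [ha0.symm, hb0.symm]), Finset.sum_pair hne, h0] at hs
  rcases hsq a (hPM ha) with h | h <;> rcases hsq b (hPM hb) with h' | h' <;>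
    norm_num [h, h'] at hs

/-- A single term gives the sum 1, and two terms would need `χ p = -1`, which is not a cube root of
unity. So `P` has three elements and is all of `M`. -/
theorem add_mem_of_sum_eq_zero_of_three_torsion (hadd_mem : ∀ a ∈ M, ∀ b ∈ M, a + b ∈ M)
    (h3 : ∀ a ∈ M, a + a + a = 0) (hcard : M.ncard ≤ 3) : ∀ a ∈ P, ∀ b ∈ P, a + b ∈ P := by
  classical
  have hPM' : (P : Set A) = M := by
    refine Set.eq_of_subset_of_ncard_le hPM (hcard.trans ?_) hM
    rw [Set.ncard_coe_finset]
    by_contra! hlt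
    have hpos : 0 < P.card := Finset.card_pos.mpr ⟨0, hP0⟩
    obtain h1 | h2 : P.card = 1 ∨ P.card = 2 := by omega
    · obtain ⟨p, rfl⟩ := Finset.card_eq_one.mp h1
      rw [← Finset.mem_singleton.mp hP0, Finset.sum_singleton, h0] at hs
      exact one_ne_zero hs
    · have he : (P.erase 0).card = 1 := by rw [Finset.card_erase_of_mem hP0, h2]
      obtain ⟨p, hp⟩ := Finset.card_eq_one.mp he
      rw [← Finset.add_sum_erase _ _ hP0, hp, Finset.sum_singleton, h0] at hs
      have hpP : p ∈ P := Finset.mem_of_mem_erase (hp ▸ Finset.mem_singleton_self p)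
      have h := congrArg χ (h3 p (hPM hpP))
      rw [hadd, hadd, h0, eq_neg_of_add_eq_zero_right hs] at h
      norm_num at h
  intro a ha b hb
  rw [← Finset.mem_coe, hPM'] at *
  exact hadd_mem a ha b hb

end charactersum

theorem torusChar_sub_eq_one {N : ℕ} {G : Subgroup (CongruenceGroup N)}
    {l : reciprocal (translationLattice G)} {v w : TorusOf G} (h : torusChar l v = torusChar l w) :
    torusChar l (v - w) = 1 := by
  have := torusChar_add l (v - w) w
  rw [sub_add_cancel, h, eq_comm] at this
  exact (mul_eq_right₀ (torusChar_ne_zero l w)).mp this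

theorem finite_and_ncard_le_of_injOn {α β : Type*} {s : Set α} {t : Finset β} {f : α → β} {n : ℕ}
    (hf : Set.MapsTo f s t) (hi : Set.InjOn f s) (hn : t.card ≤ n) : s.Finite ∧ s.ncard ≤ n := by
  refine ⟨Set.Finite.of_injOn hf hi t.finite_toSet, ?_⟩
  refine (Set.ncard_le_ncard_of_injOn f hf hi t.finite_toSet).trans ?_
  rwa [Set.ncard_coe_finset]

/-! ### Rotations in `G` and their fixed points on the torus -/

section rotation

variable {G : Subgroup (CongruenceGroup 2)} {H : Subgroup G}

/-- The elements of `G` permute the fixed points of a rotation in `G`. -/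
theorem rotation_apply_sub_mem {k σ : CongruenceGroup 2} (hk : k ∈ G) (hσ : σ ∈ G)
    (hr : IsRotation (orthPart k)) {x : Euc 2} (hx : k x - x ∈ translationLattice G) :
    k (σ x) - σ x ∈ translationLattice G := by
  have h1 : σ (k x) - σ x ∈ translationLattice G := by
    rw [apply_sub_apply]; exact orthPart_mem hσ hx
  rcases isRotation_or_isReflection σ with hσ' | hσ'
  -- Plane rotations commute, so `k σ` and `σ k` differ by a lattice translation.
  · have h2 := apply_sub_mem_of_orthPart_eq (G.mul_mem hk hσ) (G.mul_mem hσ hk) (fun y => by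
      obtain ⟨c, s, -, hA⟩ := hr
      obtain ⟨c', s', -, hB⟩ := hσ'
      rw [orthPart_mul, orthPart_mul]
      apply plane_ext <;> simp only [hA, hB] <;> ring) x
    have h3 := add_mem h2 h1
    change k (σ x) - σ (k x) + _ ∈ _ at h3
    rwa [sub_add_sub_cancel] at h3
  -- A reflection conjugates a rotation to its inverse, so `k σ k` and `σ` have the same orthogonal
  -- part.
  · have h2 := apply_sub_mem_of_orthPart_eq (G.mul_mem hk (G.mul_mem hσ hk)) hσ (fun y => by
      have h := (hr.comp_isReflection hσ').apply_apply
      have h' := h (orthPart σ y)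
      simp only [ContinuousLinearMap.comp_apply, hσ'.apply_apply] at h'
      rw [orthPart_mul, orthPart_mul, h']) x
    have h3 : k (σ (k x)) - k (σ x) ∈ translationLattice G := by
      rw [apply_sub_apply]; exact orthPart_mem hk h1
    have h4 := sub_mem h2 h3
    change k (σ (k x)) - σ x - _ ∈ _ at h4
    rwa [sub_sub_sub_cancel_left, ← neg_sub, neg_mem_iff, ← neg_sub, neg_mem_iff] at h4

/-- The points `v` of the torus that are fixed by the orthogonal part of `k`. -/
noncomputable def orthFixed {N : ℕ} {G : Subgroup (CongruenceGroup N)} (k : G) :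
    Submodule ℤ (TorusOf G) :=
  LinearMap.ker (Submodule.mapQ (translationLattice G) (translationLattice G)
      ((orthPart (k : CongruenceGroup N)).toLinearMap.restrictScalars ℤ)
      (fun _ hν => orthPart_mem k.2 hν) - LinearMap.id)

theorem mk_mem_orthFixed {N : ℕ} {G : Subgroup (CongruenceGroup N)} {k : G} {d : Euc N} :
    (Submodule.Quotient.mk d : TorusOf G) ∈ orthFixed k ↔
      orthPart (k : CongruenceGroup N) d - d ∈ translationLattice G := by
  rw [orthFixed, LinearMap.mem_ker, LinearMap.sub_apply, sub_eq_zero, ← Submodule.Quotient.eq]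
  exact Iff.rfl

theorem mk_sub_mk_mem_orthFixed {N : ℕ} {G : Subgroup (CongruenceGroup N)} {k : G} {x y : Euc N}
    (hx : (k : CongruenceGroup N) x - x ∈ translationLattice G)
    (hy : (k : CongruenceGroup N) y - y ∈ translationLattice G) :
    (Submodule.Quotient.mk y - Submodule.Quotient.mk x : TorusOf G) ∈ orthFixed k := by
  rw [← Submodule.Quotient.mk_sub, mk_mem_orthFixed, ← apply_sub_apply]
  convert sub_mem hy hx using 1
  abel

theorem orbitDisplacements_subset [Fintype (G ⧸ translationSubgroup G)] {k : G}
    (hr : IsRotation (orthPart (k : CongruenceGroup 2))) {x : Euc 2}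
    (hx : (k : CongruenceGroup 2) x - x ∈ translationLattice G) :
    (orbitDisplacements (Submodule.Quotient.mk x : TorusOf G) : Set (TorusOf G)) ⊆
      orthFixed k := by
  intro p hp
  obtain ⟨σ, rfl⟩ := exists_smul_sub_of_mem_orbitDisplacements (Finset.mem_coe.mp hp)
  rw [smul_mk_torus]
  exact mk_sub_mk_mem_orthFixed hx (rotation_apply_sub_mem k.2 σ.2 hr hx)

variable {l m : Euc 2} (hb : IsLatticeBasis (reciprocal (translationLattice G)) ![l, m])
include hb

theorem mk_eq_zero_of_inner {d : Euc 2} (hl : ∃ n : ℤ, inner ℝ d l = n)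
    (hm : ∃ n : ℤ, inner ℝ d m = n) : (Submodule.Quotient.mk d : TorusOf G) = 0 := by
  refine (Submodule.Quotient.mk_eq_zero _).mpr (mem_translationLattice_of_inner hb fun i => ?_)
  fin_cases i <;> assumption

theorem torus_eq_zero_of_torusChar {v : TorusOf G} (hl : torusChar ⟨l, hb.left_mem⟩ v = 1)
    (hm : torusChar ⟨m, hb.right_mem⟩ v = 1) : v = 0 := by
  obtain ⟨d, rfl⟩ := Submodule.Quotient.mk_surjective _ v
  exact mk_eq_zero_of_inner hb (phase_eq_one_iff.mp hl) (phase_eq_one_iff.mp hm)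

theorem torusChar_pair_injective : Function.Injective fun v : TorusOf G =>
    (torusChar ⟨l, hb.left_mem⟩ v, torusChar ⟨m, hb.right_mem⟩ v) := fun _ _ h =>
  sub_eq_zero.mp (torus_eq_zero_of_torusChar hb
    (torusChar_sub_eq_one (Prod.ext_iff.mp h).1) (torusChar_sub_eq_one (Prod.ext_iff.mp h).2))

theorem t1Space_torus : T1Space (TorusOf G) := by
  refine t1Space_of_injective_of_continuous
    (f := fun v : TorusOf G => (torusChar ⟨l, hb.left_mem⟩ v, torusChar ⟨m, hb.right_mem⟩ v))
    (torusChar_pair_injective hb)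
    ((continuous_torusChar _).prodMk (continuous_torusChar _))

/-- The matrix of a rotation in the point group with respect to a lattice basis. -/
theorem rotation_matrix {σ : CongruenceGroup 2} (hσ : σ ∈ G) {c s : ℝ} (hcs : c ^ 2 + s ^ 2 = 1)
    (hA : ∀ x, orthPart σ x 0 = c * x 0 - s * x 1 ∧ orthPart σ x 1 = s * x 0 + c * x 1) :
    ∃ a b a' b' : ℤ, orthPart σ l = a • l + b • m ∧ orthPart σ m = a' • l + b' • m ∧
      ((a + b' : ℤ) : ℝ) = 2 * c ∧ a * b' - b * a' = 1 := by
  obtain ⟨a, b, h⟩ := (hb.mem_iff _).mp (orthPart_mem_reciprocal hσ hb.left_mem)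
  obtain ⟨a', b', h'⟩ := (hb.mem_iff _).mp (orthPart_mem_reciprocal hσ hb.right_mem)
  refine ⟨a, b, a', b', h, h', ?_⟩
  have hw := hb.wedge_ne_zero
  rw [← Int.cast_smul_eq_zsmul ℝ, ← Int.cast_smul_eq_zsmul ℝ] at h h'
  have e0 := congrArg (fun x : Euc 2 => x 0) h
  have e1 := congrArg (fun x : Euc 2 => x 1) h
  have e0' := congrArg (fun x : Euc 2 => x 0) h'
  have e1' := congrArg (fun x : Euc 2 => x 1) h'
  simp only [hA, PiLp.add_apply, PiLp.smul_apply, smul_eq_mul] at e0 e1 e0' e1'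
  constructor
  · refine mul_right_cancel₀ hw ?_
    push_cast
    linear_combination - m 1 * e0 + m 0 * e1 - l 0 * e1' + l 1 * e0'
  · have : ((a * b' - b * a' : ℤ) : ℝ) = 1 := by
      refine mul_right_cancel₀ hw ?_
      push_cast
      have h3 : (a * l 0 + b * m 0) * (a' * l 1 + b' * m 1)
          - (a * l 1 + b * m 1) * (a' * l 0 + b' * m 0) = l 0 * m 1 - l 1 * m 0 := by
        rw [← e0, ← e1, ← e0', ← e1']
        linear_combination (l 0 * m 1 - l 1 * m 0) * hcs
      linear_combination h3
    exact_mod_cast this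

/-- A group that contains a proper rotation contains a rotation of order two or three. -/
theorem exists_rotation_of_order_two_or_three {h : G} (hh : h ∈ H)
    (hr : IsRotation (orthPart (h : CongruenceGroup 2)))
    (hne : ∃ u, orthPart (h : CongruenceGroup 2) u ≠ u) :
    ∃ k ∈ H, IsRotation (orthPart (k : CongruenceGroup 2)) ∧
      ((∀ u, orthPart (k : CongruenceGroup 2) u = -u) ∨
        ∀ u, orthPart (k : CongruenceGroup 2) (orthPart (k : CongruenceGroup 2) u) +
          orthPart (k : CongruenceGroup 2) u + u = 0) := by
  have hr' := hr
  obtain ⟨c, s, hcs, hA⟩ := hr'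
  obtain ⟨a, b, a', b', -, -, ht, -⟩ := rotation_matrix hb h.2 hcs hA
  generalize a + b' = t at ht
  have h1 : (t : ℝ) ≤ 2 := by nlinarith [sq_nonneg s]
  have h2 : (-2 : ℝ) ≤ t := by nlinarith [sq_nonneg s]
  have h1' : t ≤ 2 := by exact_mod_cast h1
  have h2' : -2 ≤ t := by exact_mod_cast h2
  have hs2 : s * s = 1 - c * c := by linarith
  -- Crystallographic restriction: the integral traces -2, -1, 0, 1, 2 belong to orders 2, 3, 4, 6,
  -- 1. Order 4 is squared and order 6 is cubed to reach a half-turn.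
  interval_cases t <;> push_cast at ht
  · have hc : c = -1 := by linarith
    have hs : s = 0 := by subst hc; nlinarith
    exact ⟨h, hh, hr, Or.inl fun u => plane_ext (by simp [hA, hc, hs]) (by simp [hA, hc, hs])⟩
  · have hc : c = -(1 / 2) := by linarith
    refine ⟨h, hh, hr, Or.inr fun u => plane_ext ?_ ?_⟩ <;>
      simp only [hA, PiLp.add_apply, PiLp.zero_apply] <;> subst hc
    · linear_combination - u 0 * hs2
    · linear_combination - u 1 * hs2
  · have hc : c = 0 := by linarith
    refine ⟨h * h, H.mul_mem hh hh, hr.comp hr, Or.inl fun u => plane_ext ?_ ?_⟩ <;>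
      rw [Subgroup.coe_mul, orthPart_mul] <;> simp only [hA, PiLp.neg_apply] <;> subst hc
    · linear_combination - u 0 * hs2
    · linear_combination - u 1 * hs2
  · have hc : c = 1 / 2 := by linarith
    refine ⟨h * (h * h), H.mul_mem hh (H.mul_mem hh hh), hr.comp (hr.comp hr),
      Or.inl fun u => plane_ext ?_ ?_⟩ <;>
      rw [Subgroup.coe_mul, Subgroup.coe_mul, orthPart_mul, orthPart_mul] <;>
      simp only [hA, PiLp.neg_apply] <;> subst hc
    · linear_combination (- 3 / 2 * u 0 + s * u 1) * hs2
    · linear_combination (- 3 / 2 * u 1 - s * u 0) * hs2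
  · have hc : c = 1 := by linarith
    have hs : s = 0 := by subst hc; nlinarith
    obtain ⟨u, hu⟩ := hne
    exact absurd (plane_ext (by simp [hA, hc, hs]) (by simp [hA, hc, hs])) hu

omit hb in
theorem two_torsion_of_neg {k : G} (hk : ∀ u, orthPart (k : CongruenceGroup 2) u = -u)
    {v : TorusOf G} (hv : v ∈ orthFixed k) : v + v = 0 := by
  obtain ⟨d, rfl⟩ := Submodule.Quotient.mk_surjective _ v
  rw [mk_mem_orthFixed, hk] at hv
  rw [← Submodule.Quotient.mk_add, Submodule.Quotient.mk_eq_zero, ← neg_mem_iff]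
  convert hv using 1
  abel

theorem ncard_le_four_of_neg {k : G} (hk : ∀ u, orthPart (k : CongruenceGroup 2) u = -u) :
    (orthFixed k : Set (TorusOf G)).Finite ∧ (orthFixed k : Set (TorusOf G)).ncard ≤ 4 := by
  classical
  have hsq : ∀ (y : reciprocal (translationLattice G)), ∀ v ∈ orthFixed k,
      torusChar y v ∈ ({1, -1} : Finset ℂ) := fun y v hv => by
    simpa using mul_self_eq_one_iff.mp (by
      rw [← torusChar_add, two_torsion_of_neg hk hv, torusChar_zero] :
      torusChar y v * torusChar y v = 1)
  refine finite_and_ncard_le_of_injOn (t := {1, -1} ×ˢ {1, -1})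
    (fun v hv => ?_) (torusChar_pair_injective hb).injOn ?_
  · exact Finset.mem_coe.mpr (Finset.mem_product.mpr ⟨hsq _ v hv, hsq _ v hv⟩)
  · rw [Finset.card_product]
    exact Nat.mul_le_mul (Finset.card_le_two) (Finset.card_le_two)

omit hb in
theorem three_torsion_of_order_three {k : G}
    (hk : ∀ u, orthPart (k : CongruenceGroup 2) (orthPart (k : CongruenceGroup 2) u) +
          orthPart (k : CongruenceGroup 2) u + u = 0)
    {v : TorusOf G} (hv : v ∈ orthFixed k) : v + v + v = 0 := by
  obtain ⟨d, rfl⟩ := Submodule.Quotient.mk_surjective _ v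
  rw [mk_mem_orthFixed] at hv
  have h2 := orthPart_mem k.2 hv
  rw [map_sub] at h2
  rw [← Submodule.Quotient.mk_add, ← Submodule.Quotient.mk_add, Submodule.Quotient.mk_eq_zero,
    ← neg_mem_iff]
  convert add_mem h2 (add_mem hv hv) using 1
  rw [← sub_eq_zero, ← neg_eq_zero, ← hk d]
  abel

/-- The matrix `A` of `k` has trace -1 and determinant 1, so `det (1 - A) = 3` and fixed points have
coordinates in `ℤ/3`. If an off-diagonal entry is prime to 3, integrality of one coordinate forces
that of the other. This gives the bound 3 on the fixed group, where 3-torsion alone would allow 9.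
-/
theorem exists_separating_torusChar {k : G} (hr : IsRotation (orthPart (k : CongruenceGroup 2)))
    (hk : ∀ u, orthPart (k : CongruenceGroup 2) (orthPart (k : CongruenceGroup 2) u) +
          orthPart (k : CongruenceGroup 2) u + u = 0) :
    ∃ y : reciprocal (translationLattice G), ∀ v ∈ orthFixed k, torusChar y v = 1 → v = 0 := by
  obtain ⟨c, s, hcs, hA⟩ := hr
  obtain ⟨a, b, a', b', hl, hm, ht, hdet⟩ := rotation_matrix hb k.2 hcs hA
  have htr : a + b' = -1 := by
    have h0 := congrArg (fun x : Euc 2 => x 0) (hk l)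
    have h1 := congrArg (fun x : Euc 2 => x 1) (hk l)
    simp only [hA, PiLp.add_apply, PiLp.zero_apply] at h0 h1
    have hp := (plane_ne_zero hb.left_ne_zero).ne'
    have hc : c * (2 * c + 1) = 0 := by
      refine mul_left_cancel₀ hp ?_
      linear_combination l 0 * h0 + l 1 * h1 + (l 0 ^ 2 + l 1 ^ 2) * hcs
    have hs : s * (2 * c + 1) = 0 := by
      refine mul_left_cancel₀ hp ?_
      linear_combination l 0 * h1 - l 1 * h0
    have h2 : 2 * c = -1 := by linear_combination c * hc + s * hs - (2 * c + 1) * hcs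
    rw [h2] at ht
    exact_mod_cast ht
  have hrel : ∀ d : Euc 2, (Submodule.Quotient.mk d : TorusOf G) ∈ orthFixed k →
      ∃ n₁ n₂ : ℤ, inner ℝ d l - (a * inner ℝ d l + b * inner ℝ d m) = n₁ ∧
        inner ℝ d m - (a' * inner ℝ d l + b' * inner ℝ d m) = n₂ := by
    intro d hd
    rw [mk_mem_orthFixed] at hd
    obtain ⟨n₁, h₁⟩ := mem_reciprocal.mp (orthPart_mem_reciprocal k.2 hb.left_mem) _ hd
    obtain ⟨n₂, h₂⟩ := mem_reciprocal.mp (orthPart_mem_reciprocal k.2 hb.right_mem) _ hd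
    refine ⟨n₁, n₂, ?_, ?_⟩
    · rw [← h₁, inner_sub_left, inner_orthPart, hl, inner_add_right, ← Int.cast_smul_eq_zsmul ℝ,
        ← Int.cast_smul_eq_zsmul ℝ, inner_smul_right, inner_smul_right]
    · rw [← h₂, inner_sub_left, inner_orthPart, hm, inner_add_right, ← Int.cast_smul_eq_zsmul ℝ,
        ← Int.cast_smul_eq_zsmul ℝ, inner_smul_right, inner_smul_right]
  have htr' : (a : ℝ) + b' = -1 := by exact_mod_cast htr
  have hdet' : (a : ℝ) * b' - b * a' = 1 := by exact_mod_cast hdet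
  have bezout : ∀ (e : ℤ) (r : ℝ), ¬ 3 ∣ e → (∃ n : ℤ, e * r = n) → (∃ n : ℤ, 3 * r = n) →
      ∃ n : ℤ, r = n := by
    rintro e r he ⟨n, hn⟩ ⟨n', hn'⟩
    obtain ⟨x, y, hxy⟩ := (Int.isCoprime_iff_gcd_eq_one.mpr
      ((Nat.Prime.coprime_iff_not_dvd Nat.prime_three).mpr fun h => he (Int.natCast_dvd.mpr h)) :
      IsCoprime (3 : ℤ) e)
    refine ⟨x * n' + y * n, ?_⟩
    have hxy' : (x : ℝ) * 3 + y * e = 1 := by exact_mod_cast hxy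
    push_cast
    rw [← hn, ← hn']
    linear_combination - r * hxy'
  by_cases hb3 : 3 ∣ b
  · have ha3 : ¬ 3 ∣ a' := by
      rintro ⟨x, rfl⟩
      obtain ⟨y, rfl⟩ := hb3
      obtain rfl : b' = -1 - a := by linarith
      -- If 3 divided both off-diagonal entries, then `a² + a + 1` would be divisible by 9, which no
      -- residue of `a` modulo 3 permits.
      have h9 : a * a + a + 1 = -9 * (x * y) := by linarith
      have h3 : a % 3 = 0 ∨ a % 3 = 1 ∨ a % 3 = 2 := by omega
      rcases h3 with h3 | h3 | h3
      · obtain ⟨z, rfl⟩ : ∃ z, a = 3 * z := ⟨a / 3, by omega⟩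
        ring_nf at h9; omega
      · obtain ⟨z, rfl⟩ : ∃ z, a = 3 * z + 1 := ⟨a / 3, by omega⟩
        ring_nf at h9; omega
      · obtain ⟨z, rfl⟩ : ∃ z, a = 3 * z + 2 := ⟨a / 3, by omega⟩
        ring_nf at h9; omega
    refine ⟨⟨m, hb.right_mem⟩, fun v hv h => ?_⟩
    obtain ⟨d, rfl⟩ := Submodule.Quotient.mk_surjective _ v
    obtain ⟨n, hn⟩ := phase_eq_one_iff.mp h
    obtain ⟨n₁, n₂, h₁, h₂⟩ := hrel d hv
    -- The second witness comes from multiplying by the adjugate of `1 - A`, which gives three times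
    -- the coordinate.
    refine mk_eq_zero_of_inner hb (bezout a' _ ha3 ⟨n - b' * n - n₂, ?_⟩
      ⟨(1 - b') * n₁ + b * n₂, ?_⟩) ⟨n, hn⟩
    · push_cast
      rw [← hn, ← h₂]; ring
    · push_cast
      rw [← h₁, ← h₂]
      linear_combination inner ℝ d l * htr' - inner ℝ d l * hdet'
  · refine ⟨⟨l, hb.left_mem⟩, fun v hv h => ?_⟩
    obtain ⟨d, rfl⟩ := Submodule.Quotient.mk_surjective _ v
    obtain ⟨n, hn⟩ := phase_eq_one_iff.mp h
    obtain ⟨n₁, n₂, h₁, h₂⟩ := hrel d hv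
    refine mk_eq_zero_of_inner hb ⟨n, hn⟩ (bezout b _ hb3 ⟨n - a * n - n₁, ?_⟩
      ⟨(1 - a) * n₂ + a' * n₁, ?_⟩)
    · push_cast
      rw [← hn, ← h₁]; ring
    · push_cast
      rw [← h₁, ← h₂]
      linear_combination inner ℝ d m * htr' - inner ℝ d m * hdet'

theorem ncard_le_three_of_order_three {k : G}
    (hr : IsRotation (orthPart (k : CongruenceGroup 2)))
    (hk : ∀ u, orthPart (k : CongruenceGroup 2) (orthPart (k : CongruenceGroup 2) u) +
          orthPart (k : CongruenceGroup 2) u + u = 0) :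
    (orthFixed k : Set (TorusOf G)).Finite ∧ (orthFixed k : Set (TorusOf G)).ncard ≤ 3 := by
  classical
  obtain ⟨y, hy⟩ := exists_separating_torusChar hb hr hk
  refine finite_and_ncard_le_of_injOn (f := torusChar y)
    (t := (Polynomial.nthRoots 3 (1 : ℂ)).toFinset) (fun v hv => ?_) (fun v hv w hw h => ?_)
    ((Multiset.toFinset_card_le _).trans (Polynomial.card_nthRoots 3 1))
  · rw [Finset.mem_coe, Multiset.mem_toFinset, Polynomial.mem_nthRoots (by norm_num),
      ← torusChar_nsmul]
    have h3 := three_torsion_of_order_three hk hv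
    rw [show 3 • v = v + v + v by abel, h3, torusChar_zero]
  · exact sub_eq_zero.mp (hy _ (sub_mem hv hw) (torusChar_sub_eq_one h))

end rotation

/-! ### Groups `H` with a proper rotation -/

section absence

variable {G : Subgroup (CongruenceGroup 2)} {H : Subgroup G} {l m : Euc 2}
  (hb : IsLatticeBasis (reciprocal (translationLattice G)) ![l, m])
include hb

/-- A nonzero finite subgroup of the torus on which the characters outside `Γ_ext` are trivial
gives rise to a larger lattice. -/
theorem not_detectsLattice_of_torusChar {U : Set (TorusOf G)} {M : Submodule ℤ (TorusOf G)} {n : ℕ}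
    (hn : n ≠ 0) (hnM : ∀ v ∈ M, n • v = 0) (hM : M ≠ ⊥)
    (htriv : ∀ y (hy : y ∈ reciprocal (translationLattice G)), y ∉ gammaExt G U →
      ∀ v ∈ M, torusChar ⟨y, hy⟩ v = 1) : ¬ DetectsLattice G U := by
  have hd : DiscreteTopology (M.comap (translationLattice G).mkQ) :=
    discreteTopology_of_nsmul_mem hb hn fun x hx =>
      (Submodule.Quotient.mk_eq_zero _).mp (hnM _ hx)
  -- The larger lattice is the preimage of `M` in the plane; it is discrete because `n` times it
  -- lies in `L`.
  refine not_not.mpr ⟨M.comap (translationLattice G).mkQ, hd, ⟨?_⟩, ?_, ?_⟩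
  · refine top_unique ((span_translationLattice hb).ge.trans (Submodule.span_mono fun x hx => ?_))
    change (Submodule.Quotient.mk x : TorusOf G) ∈ M
    rw [(Submodule.Quotient.mk_eq_zero _).mpr hx]
    exact zero_mem M
  · refine lt_of_le_of_ne (fun x hx => ?_) fun h => hM ((Submodule.eq_bot_iff _).mpr fun v hv => ?_)
    · change (Submodule.Quotient.mk x : TorusOf G) ∈ M
      rw [(Submodule.Quotient.mk_eq_zero _).mpr hx]
      exact zero_mem M
    · obtain ⟨x, rfl⟩ := Submodule.Quotient.mk_surjective _ v
      refine (Submodule.Quotient.mk_eq_zero _).mpr ?_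
      rw [h]
      exact hv
  · rintro y ⟨hy, hyΓ⟩
    exact mem_reciprocal.mpr fun x hx => phase_eq_one_iff.mp (htriv y hy hyΓ _ hx)

/-- The fixed points of a group that contains a rotation of order two or three are isolated. -/
theorem component_eq_singleton {k : G} (hk : k ∈ H)
    (hfin : (orthFixed k : Set (TorusOf G)).Finite) {x : Euc 2}
    (hx : (Submodule.Quotient.mk x : TorusOf G) ∈ MulAction.fixedPoints H (TorusOf G)) :
    connectedComponentIn (MulAction.fixedPoints H (TorusOf G)) (Submodule.Quotient.mk x) =
      {Submodule.Quotient.mk x} := by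
  have := t1Space_torus hb
  refine Set.Subsingleton.eq_singleton_of_mem ?_ (mem_connectedComponentIn hx)
  by_contra hnt
  -- In a T1 space a connected set with two points is infinite, whereas the fixed points of `H` lie
  -- in one translate of the finite group `orthFixed k`.
  refine isPreconnected_connectedComponentIn.infinite_of_nontrivial
    (Set.not_subsingleton_iff.mp hnt) ((hfin.image (Submodule.Quotient.mk x + ·)).subset ?_)
  intro v hv
  have hv' := connectedComponentIn_subset _ _ hv
  obtain ⟨y, rfl⟩ := Submodule.Quotient.mk_surjective _ v
  exact ⟨_, mk_sub_mk_mem_orthFixed (mk_mem_fixedPoints.mp hx k hk)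
    (mk_mem_fixedPoints.mp hv' k hk), add_sub_cancel _ _⟩

theorem exists_torsion_of_rotation [Fintype (G ⧸ translationSubgroup G)] {x : Euc 2} {k : G}
    (hx : (k : CongruenceGroup 2) x - x ∈ translationLattice G)
    (hkr : IsRotation (orthPart (k : CongruenceGroup 2)))
    (hkord : (∀ u, orthPart (k : CongruenceGroup 2) u = -u) ∨
      ∀ u, orthPart (k : CongruenceGroup 2) (orthPart (k : CongruenceGroup 2) u) +
        orthPart (k : CongruenceGroup 2) u + u = 0) :
    (orthFixed k : Set (TorusOf G)).Finite ∧ (∃ n : ℕ, n ≠ 0 ∧ ∀ v ∈ orthFixed k, n • v = 0) ∧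
      ∀ y : reciprocal (translationLattice G),
        ∑ p ∈ orbitDisplacements (Submodule.Quotient.mk x : TorusOf G), torusChar y p = 0 →
        ∀ a ∈ orbitDisplacements (Submodule.Quotient.mk x : TorusOf G),
          ∀ b ∈ orbitDisplacements (Submodule.Quotient.mk x : TorusOf G),
            a + b ∈ orbitDisplacements (Submodule.Quotient.mk x : TorusOf G) := by
  have hPM := orbitDisplacements_subset hkr hx
  have h0 := zero_mem_orbitDisplacements (Submodule.Quotient.mk x : TorusOf G)
  rcases hkord with hneg | h3
  · obtain ⟨hfin, hcard⟩ := ncard_le_four_of_neg hb hneg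
    refine ⟨hfin, ⟨2, two_ne_zero, fun v hv => ?_⟩, fun y hy => ?_⟩
    · rw [two_nsmul, two_torsion_of_neg hneg hv]
    · exact add_mem_of_sum_eq_zero_of_two_torsion (torusChar_add y) (torusChar_zero y) h0 hfin
        hPM hy (fun a ha b hb => add_mem ha hb) (fun a ha => two_torsion_of_neg hneg ha) hcard
  · obtain ⟨hfin, hcard⟩ := ncard_le_three_of_order_three hb hkr h3
    refine ⟨hfin, ⟨3, three_ne_zero, fun v hv => ?_⟩, fun y hy => ?_⟩
    · rw [← three_torsion_of_order_three h3 hv]; abel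
    · exact add_mem_of_sum_eq_zero_of_three_torsion (torusChar_add y) (torusChar_zero y) h0 hfin
        hPM hy (fun a ha b hb => add_mem ha hb)
        (fun a ha => three_torsion_of_order_three h3 ha) hcard

/-- A finite orbit sum vanishes for a reciprocal lattice vector only if the orbit is periodic with
respect to a larger lattice. -/
theorem not_detectsLattice_singleton [Fintype (G ⧸ translationSubgroup G)] {v : TorusOf G}
    {M : Submodule ℤ (TorusOf G)} {n : ℕ} (hn : n ≠ 0) (hnM : ∀ v ∈ M, n • v = 0)
    (hPM : (orbitDisplacements v : Set (TorusOf G)) ⊆ M)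
    (hclosed : ∀ a ∈ orbitDisplacements v, ∀ b ∈ orbitDisplacements v,
      a + b ∈ orbitDisplacements v)
    {y : reciprocal (translationLattice G)} (hy : v ∈ vanishingSet y) :
    ¬ DetectsLattice G {v} := by
  have hsum := (mem_vanishingSet_iff _ _).mp hy
  refine not_detectsLattice_of_torusChar hb
    (M := Submodule.span ℤ (orbitDisplacements v : Set (TorusOf G)))
    hn (fun w hw => hnM w (Submodule.span_le.mpr hPM hw)) (fun hbot => ?_) (fun z hz hzΓ w hw => ?_)
  -- The span is nonzero, for otherwise the vanishing orbit sum would be the single term 1.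
  · have hP : orbitDisplacements v = {0} :=
      Finset.eq_singleton_iff_unique_mem.mpr ⟨zero_mem_orbitDisplacements v,
        fun p hp => Submodule.span_eq_bot.mp hbot p hp⟩
    rw [hP, Finset.sum_singleton, torusChar_zero] at hsum
    exact one_ne_zero hsum
  · have hz' : ∑ p ∈ orbitDisplacements v, torusChar ⟨z, hz⟩ p ≠ 0 := fun h =>
      hzΓ ⟨hz, Set.singleton_subset_iff.mpr ((mem_vanishingSet_iff _ _).mpr h)⟩
    rw [← Submodule.mem_toAddSubgroup, Submodule.span_int_eq_addSubgroupClosure] at hw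
    induction hw using AddSubgroup.closure_induction with
    | mem p hp => exact eq_one_of_sum_ne_zero (torusChar_add _) hclosed hz' hp
    | zero => exact torusChar_zero _
    | add v w _ _ hv hw => rw [torusChar_add, hv, hw, mul_one]
    | neg v _ hv => exact torusChar_neg_eq_one hv

/-- If `H` contains a proper rotation, then there are no extinct reciprocal lattice vectors. -/
theorem notMem_gammaExt_of_rotation {x : Euc 2}
    (hx : (Submodule.Quotient.mk x : TorusOf G) ∈ MulAction.fixedPoints H (TorusOf G))
    (hvalid : DetectsLattice G (connectedComponentIn (MulAction.fixedPoints H (TorusOf G))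
      (Submodule.Quotient.mk x)))
    {h : G} (hh : h ∈ H) (hr : IsRotation (orthPart (h : CongruenceGroup 2)))
    (hne : ∃ u, orthPart (h : CongruenceGroup 2) u ≠ u) (y : Euc 2) :
    y ∉ gammaExt G (connectedComponentIn (MulAction.fixedPoints H (TorusOf G))
      (Submodule.Quotient.mk x)) := by
  have := finite_quotient hb
  have := Fintype.ofFinite (G ⧸ translationSubgroup G)
  obtain ⟨k, hk, hkr, hkord⟩ := exists_rotation_of_order_two_or_three hb hh hr hne
  have hkx := mk_mem_fixedPoints.mp hx k hk
  obtain ⟨hfin, ⟨n, hn, htors⟩, hclosed⟩ := exists_torsion_of_rotation hb hkx hkr hkord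
  rw [component_eq_singleton hb hk hfin hx] at hvalid ⊢
  rintro ⟨hy, hyU⟩
  have hv := hyU (Set.mem_singleton _)
  exact not_detectsLattice_singleton hb hn htors (orbitDisplacements_subset hkr hkx)
    (hclosed _ ((mem_vanishingSet_iff _ _).mp hv)) hv hvalid

end absence

/-! ### Conclusion -/

theorem theorem1 (G : Subgroup (CongruenceGroup 2)) (H : Subgroup G) (U : Set (TorusOf G))
    (hGHU : IsAbsenceType G H U) (hvalid : DetectsLattice G U)
    (l : Euc 2) (hprim : IsPrimitiveVector (reciprocal (translationLattice G)) l)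
    (hl : l ∈ gammaExt G U) :
    ∃ l₂ ∈ reciprocal (translationLattice G), inner ℝ l l₂ = 0 ∧
      IsLatticeBasis (reciprocal (translationLattice G)) ![l, l₂] := by
  obtain ⟨v, hv, rfl⟩ := hGHU.component
  obtain ⟨x, rfl⟩ := Submodule.Quotient.mk_surjective _ v
  obtain ⟨m, hb⟩ := hprim.exists_basis
  refine orthogonal_basis_of_no_rotation hb hv hl fun h hh hr => ?_
  by_contra! hne
  exact notMem_gammaExt_of_rotation hb hv hvalid hh hr hne l hl
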